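/- Let $a_0$ be a holomorphic function near $0\in\mathbb C$, and consider, for complex variables $(t,x)\in\mathbb C^2$, the ramified Cauchy problem $$u_t-u\,u_x=0,\qquad u(0,x)=a_0(x)+x^{1/3}.\tag{1}$$ There are a connected open neighbourhood $U$ of $(0,0)\in\mathbb C^2$ and holomorphic functions $a,p,q:U\to\mathbb C$ with $$a(0,x)=a_0(x),\qquad p(0,x)=0,\qquad q(0,x)=x\qquad\text{whenever }(0,x)\in U,\tag{2}$$ such that, with $S=\{y\in U:\ 4p(y)^3-27q(y)^2=0\}$, the following hold. 1. If $y\in U$ and $z$ is a holomorphic germ at $y$ with $z^3=pz+q$, then $u=a+z$ satisfies $u_t-u\,u_x=0$ near $y$. 2. Let $(0,x_0)\in U$, $x_0\neq0$, and let $\omega$ be a holomorphic germ at $x_0$ with $\omega(x)^3=x$ (a branch of $x^{1/3}$). There is a holomorphic germ $z$ at $(0,x_0)$ with $z^3=pz+q$ such that $u=a+z$ satisfies $u_t-u\,u_x=0$ near $(0,x_0)$ and $u(0,x)=a_0(x)+\omega(x)$ near $x_0$; and $u$ is the only holomorphic germ at $(0,x_0)$ with the last two properties. This $u$ is ramified around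 $S$: it can be continued holomorphically along every path in $U\setminus S$ starting at $(0,x_0)$, and for every $y\in S$ and every neighbourhood $W$ of $y$ there are a path in $U\setminus S$ from $(0,x_0)$ to a point $w\in W$ and a loop at $w$ in $W\cap(U\setminus S)$ such that the germ at $w$ obtained from $u$ along the path is changed by continuation along the loop. Every germ obtained from $u$ by continuation along a path in $U\setminus S$ again satisfies $u_t-u\,u_x=0$ and is of the form $a+\tilde z$ with $\tilde z^3=p\tilde z+q$. 3. $p(0,0)=q(0,0)=0$ and the differentials $dp(0,0)$, $dq(0,0)$ are linearly independent, so $S$ is, near the origin, a cusp with edge $(0,0)$. It is characteristic for the equation: if $y\in S$ and $\zeta\in\mathbb C$ is the multiple root of $\zeta^3=p(y)\zeta+q(y)$, then $D=4p^3-27q^2$ satisfies $D_t(y)-(a(y)+\zeta)D_x(y)=0$. 4. The germs of $a,p,q$ at $(0,0)$ are unique: let $a',p',q'$ be holomorphic on a connected open neighbourhood $U'$ of $(0,0)$ and satisfy $a'(0,x)=a_0(x)$, $p'(0,x)=0$, $q'(0,x)=x$ for $x$ near $0$. If for some $y\in U'$ there is a holomorphic germ $z'$ at $y$ with $z'^3=p'z'+q'$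 such that $a'+z'$ satisfies $u_t-u\,u_x=0$ near $y$, then $a'=a$, $p'=p$, $q'=q$ near $(0,0)$. -/

import Mathlib

open Filter Topology

namespace RamifiedBurgers

/-! Points of `ℂ × ℂ` are pairs `(t, x)`. Germs at a point are represented by functions
on `ℂ × ℂ`, considered up to equality on a neighbourhood of the point. -/

/-- The complex partial derivative with respect to `t`. -/
noncomputable def timeDeriv (u : ℂ × ℂ → ℂ) (y : ℂ × ℂ) : ℂ := fderiv ℂ u y (1, 0)

/-- The complex partial derivative with respect to `x`. -/
noncomputable def spaceDeriv (u : ℂ × ℂ → ℂ) (y : ℂ × ℂ) : ℂ := fderiv ℂ u y (0, 1)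

/-- `u` is a holomorphic germ at `y` with `u_t - u u_x = 0` near `y`. -/
def SolvesBurgersNear (u : ℂ × ℂ → ℂ) (y : ℂ × ℂ) : Prop :=
  AnalyticAt ℂ u y ∧ ∀ᶠ w in 𝓝 y, timeDeriv u w - u w * spaceDeriv u w = 0

/-- `ω` is a holomorphic germ at `x₀` of a branch of `x ^ (1/3)`. -/
def IsCubeRootGerm (ω : ℂ → ℂ) (x₀ : ℂ) : Prop :=
  AnalyticAt ℂ ω x₀ ∧ ∀ᶠ x in 𝓝 x₀, ω x ^ 3 = x

/-- The germ `u` at `(0, x₀)` solves `u_t - u u_x = 0`, `u(0,x) = a₀(x) + x ^ (1/3)`, where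
`x ^ (1/3)` stands for the branch `ω` near `x₀`. -/
def SolvesIVP (a₀ ω : ℂ → ℂ) (x₀ : ℂ) (u : ℂ × ℂ → ℂ) : Prop :=
  SolvesBurgersNear u (0, x₀) ∧ ∀ᶠ x in 𝓝 x₀, u (0, x) = a₀ x + ω x

/-- `z` is a holomorphic germ at `y` with `z ^ 3 = p z + q` near `y`. -/
def IsCubicRootNear (p q z : ℂ × ℂ → ℂ) (y : ℂ × ℂ) : Prop :=
  AnalyticAt ℂ z y ∧ ∀ᶠ w in 𝓝 y, z w ^ 3 = p w * z w + q w

/-- `U` is a connected open neighbourhood of the origin on which `a`, `p`, `q` are holomorphic. -/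
structure HolomorphicNearOrigin (U : Set (ℂ × ℂ)) (a p q : ℂ × ℂ → ℂ) : Prop where
  isOpen : IsOpen U
  isPreconnected : IsPreconnected U
  zero_mem : (0, 0) ∈ U
  analytic_a : AnalyticOnNhd ℂ a U
  analytic_p : AnalyticOnNhd ℂ p U
  analytic_q : AnalyticOnNhd ℂ q U

/-- The function `4 p ^ 3 - 27 q ^ 2`. -/
def discr (p q : ℂ × ℂ → ℂ) (y : ℂ × ℂ) : ℂ := 4 * p y ^ 3 - 27 * q y ^ 2

/-- The locus `4 p ^ 3 - 27 q ^ 2 = 0` in `U`. -/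
def cusp (U : Set (ℂ × ℂ)) (p q : ℂ × ℂ → ℂ) : Set (ℂ × ℂ) := {y ∈ U | discr p q y = 0}

/-- The family of germs `f s` at `γ s` is an analytic continuation along the path `γ`. -/
def IsContinuationAlong {y₀ y₁ : ℂ × ℂ} (γ : Path y₀ y₁)
    (f : unitInterval → ℂ × ℂ → ℂ) : Prop :=
  (∀ s, AnalyticAt ℂ (f s) (γ s)) ∧ ∀ s, ∀ᶠ r in 𝓝 s, f r =ᶠ[𝓝 (γ r)] f s

/-- The germ `v` at `y₀` is ramified in `U` around `S`: it can be continued along every path in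
`U \ S`, and near every point of `S` some continuation of it has nontrivial monodromy, along
arbitrarily small loops. -/
def IsRamifiedAround (U S : Set (ℂ × ℂ)) (y₀ : ℂ × ℂ) (v : ℂ × ℂ → ℂ) : Prop :=
  (∀ (y₁ : ℂ × ℂ) (γ : Path y₀ y₁), (∀ s, γ s ∈ U \ S) →
    ∃ f, IsContinuationAlong γ f ∧ f 0 =ᶠ[𝓝 y₀] v) ∧
  (∀ y ∈ S, ∀ W ∈ 𝓝 y, ∃ (w : ℂ × ℂ) (γ : Path y₀ w) (δ : Path w w)
    (f g : unitInterval → ℂ × ℂ → ℂ),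
    (∀ s, γ s ∈ U \ S) ∧ (∀ s, δ s ∈ W ∩ (U \ S)) ∧
    IsContinuationAlong γ f ∧ f 0 =ᶠ[𝓝 y₀] v ∧
    IsContinuationAlong δ g ∧ g 0 =ᶠ[𝓝 w] f 1 ∧ ¬ g 1 =ᶠ[𝓝 w] g 0)

/-- The locus `4 p ^ 3 - 27 q ^ 2 = 0` is characteristic for the linearisation
`∂_t - u ∂_x` (up to order zero) of the equation at `u = a + ζ`, where `ζ` is the
multiple root of `ζ ^ 3 = p ζ + q` over a point of this locus. -/
def CuspIsCharacteristic (U : Set (ℂ × ℂ)) (a p q : ℂ × ℂ → ℂ) : Prop :=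
  ∀ y ∈ cusp U p q, ∀ ζ : ℂ, ζ ^ 3 = p y * ζ + q y → 3 * ζ ^ 2 = p y →
    timeDeriv (discr p q) y - (a y + ζ) * spaceDeriv (discr p q) y = 0

end RamifiedBurgers

/-! A solution is constant along characteristics, so with `ξ = x + t u` a branch should satisfy `(u
- a₀ ξ) ^ 3 = ξ`; conversely, holomorphic `u` satisfying this relation solve the equation
(`burgers_of_implicit`). The three branches are sought as `a + z`, with `z` the roots of `z ^ 3 = p
z + q`. To find `a`, `p`, `q` holomorphically, `u` is replaced by the matrix `a + C`, where `C` is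
the companion matrix of the cubic, and `a₀` is applied through its power series. The first column of
the matrix relation is a system of three equations in `(a, p, q)`, solvable by the implicit function
theorem. The row `(1, z, z ^ 2)` is a left eigenvector and carries the solution back to every root
(`exists_coefficients`).

For `u = a + z`, `(3 z ^ 2 - p) (u_t - u u_x)` is a quadratic polynomial in `z` whose coefficients
depend only on `a`, `p`, `q` (`burgers_add_root`). Three distinct branches force these coefficients
to vanish. The resulting first order system makes the cusp characteristic and gives `p_t = q_x = 1`
at the origin, so `(p, q)` is a local chart. In this chart, continuation is path lifting in the
covering of the `(P, Q)`-plane by the roots, off the discriminant; exchanging two roots that merge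
at a point of the cusp gives nontrivial monodromy (`isRamifiedAround_cusp`).

For uniqueness, a single branch makes the norm of the quadratic polynomial vanish near one point,
hence on all of the connected domain. At the origin `p` and `q` vanish and `q_x ≠ 0`, and an
Eisenstein argument (`eventually_coeff_eq_zero`) shows that the coefficients themselves vanish.
Every branch then solves the equation, and uniqueness for the initial value problem identifies the
two cubics. -/

namespace RamifiedBurgers

/-! ### Implicit function theorem -/

/-- The derivative of `f` along the second factor, computed on a line. -/
theorem fderiv_apply_inr {E F : Type*} [NormedAddCommGroup E] [NormedSpace ℂ E]
    [NormedAddCommGroup F] [NormedSpace ℂ F] {f : E × F → F} {x₀ : E} {y₀ v w : F}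
    (hf : DifferentiableAt ℂ f (x₀, y₀))
    (h : HasDerivAt (fun s : ℂ => f (x₀, y₀ + s • v)) w 0) :
    fderiv ℂ f (x₀, y₀) (0, v) = w := by
  have hl : HasDerivAt (fun s : ℂ => ((x₀, y₀ + s • v) : E × F)) (0, v) 0 := by
    have := ((hasDerivAt_id (0 : ℂ)).smul_const v).const_add y₀
    simpa using (hasDerivAt_const (0 : ℂ) x₀).prodMk this
  have hf' : HasFDerivAt f (fderiv ℂ f (x₀, y₀))
      ((fun s : ℂ => ((x₀, y₀ + s • v) : E × F)) 0) := by simpa using hf.hasFDerivAt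
  exact (hf'.comp_hasDerivAt (0 : ℂ) hl).unique h

section ImplicitFunction

variable {E F : Type*} [NormedAddCommGroup E] [NormedSpace ℂ E] [CompleteSpace E]
  [NormedAddCommGroup F] [NormedSpace ℂ F] [FiniteDimensional ℂ F]

theorem isInvertible_of_ker_eq_zero (f : F →L[ℂ] F) (h : ∀ v, f v = 0 → v = 0) :
    f.IsInvertible := by
  have hi : Function.Injective (f : F →ₗ[ℂ] F) := (injective_iff_map_eq_zero _).2 h
  exact ⟨(LinearEquiv.ofInjectiveEndo _ hi).toContinuousLinearEquiv, by ext v; rfl⟩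

/-- The holomorphic implicit function theorem. -/
theorem exists_analyticAt_implicit {f : E × F → F} {x₀ : E} {y₀ : F}
    (hf : AnalyticAt ℂ f (x₀, y₀)) (hker : ∀ v, fderiv ℂ f (x₀, y₀) (0, v) = 0 → v = 0) :
    ∃ g : E → F, AnalyticAt ℂ g x₀ ∧ g x₀ = y₀ ∧
      (∀ᶠ x in 𝓝 x₀, f (x, g x) = f (x₀, y₀)) ∧
      ∀ᶠ v in 𝓝 (x₀, y₀), f v = f (x₀, y₀) → v.2 = g v.1 := by
  have : CompleteSpace F := FiniteDimensional.complete ℂ F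
  have hc : ContDiffAt ℂ ⊤ f (x₀, y₀) := hf.contDiffAt
  have hi : (fderiv ℂ f (x₀, y₀) ∘L .inr ℂ E F).IsInvertible :=
    isInvertible_of_ker_eq_zero _ fun v hv => hker v (by simpa using hv)
  have hn : (⊤ : WithTop ℕ∞) ≠ 0 := by simp
  refine ⟨hc.implicitFunction hn hi, (hc.contDiffAt_implicitFunction hn hi).analyticAt,
    hc.implicitFunction_apply_self hn hi, hc.eventually_apply_implicitFunction hn hi, ?_⟩
  filter_upwards [hc.eventually_apply_eq_iff_implicitFunction hn hi] with v hv h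
  exact (hv.1 h).symm

end ImplicitFunction

/-! ### Simple branches of the cubic and the first order system for `a`, `p`, `q` -/

/-- The implicit function theorem applies because `3 ζ ^ 2 - p` is the derivative of the cubic in
`z`. Uniqueness is stated jointly in the point and the value, so that it can be evaluated along
paths. -/
theorem exists_isCubicRootNear {p q : ℂ × ℂ → ℂ} {y : ℂ × ℂ} {ζ : ℂ}
    (hp : AnalyticAt ℂ p y) (hq : AnalyticAt ℂ q y) (hζ : ζ ^ 3 = p y * ζ + q y)
    (hs : 3 * ζ ^ 2 ≠ p y) :
    ∃ z, IsCubicRootNear p q z y ∧ z y = ζ ∧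
      ∀ᶠ v in 𝓝 (y, ζ), v.2 ^ 3 = p v.1 * v.2 + q v.1 → v.2 = z v.1 := by
  set f : (ℂ × ℂ) × ℂ → ℂ := fun v => v.2 ^ 3 - (p v.1 * v.2 + q v.1) with hf_def
  have h1 : AnalyticAt ℂ (fun v : (ℂ × ℂ) × ℂ => p v.1) (y, ζ) :=
    AnalyticAt.fun_comp (f := Prod.fst) hp analyticAt_fst
  have h2 : AnalyticAt ℂ (fun v : (ℂ × ℂ) × ℂ => q v.1) (y, ζ) :=
    AnalyticAt.fun_comp (f := Prod.fst) hq analyticAt_fst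
  have hf : AnalyticAt ℂ f (y, ζ) :=
    (analyticAt_snd.pow 3).sub ((h1.mul analyticAt_snd).add h2)
  have h0 : f (y, ζ) = 0 := by simp [hf_def, hζ]
  obtain ⟨z, hz, hzy, hroot, huniq⟩ := exists_analyticAt_implicit hf (fun v hv => by
    have hd : HasDerivAt (fun s : ℂ => f (y, ζ + s • v)) ((3 * ζ ^ 2 - p y) * v) 0 := by
      have hl : HasDerivAt (fun s : ℂ => ζ + s * v) v 0 := by
        simpa using ((hasDerivAt_id (0 : ℂ)).mul_const v).const_add ζ
      have := (hl.pow 3).sub ((hl.const_mul (p y)).add_const (q y))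
      refine HasDerivAt.congr_deriv this ?_
      push_cast
      ring
    rw [fderiv_apply_inr hf.differentiableAt hd] at hv
    exact (mul_eq_zero.1 hv).resolve_left (sub_ne_zero.2 hs))
  rw [h0] at hroot huniq
  refine ⟨z, ⟨hz, ?_⟩, hzy, ?_⟩
  · filter_upwards [hroot] with w hw
    exact sub_eq_zero.1 hw
  · filter_upwards [huniq] with v hv h
    exact hv (sub_eq_zero.2 h)

theorem IsCubicRootNear.self {p q z : ℂ × ℂ → ℂ} {y : ℂ × ℂ} (h : IsCubicRootNear p q z y) :
    z y ^ 3 = p y * z y + q y := h.2.self_of_nhds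

/-- A simple root of the cubic has only one continuous extension to a root. -/
theorem eventuallyEq_of_cubic_root {p q z₁ z₂ : ℂ × ℂ → ℂ} {y : ℂ × ℂ}
    (hp : AnalyticAt ℂ p y) (hq : AnalyticAt ℂ q y)
    (h₁ : IsCubicRootNear p q z₁ y) (h₂ : IsCubicRootNear p q z₂ y) (h : z₁ y = z₂ y)
    (hs : 3 * z₁ y ^ 2 ≠ p y) : z₁ =ᶠ[𝓝 y] z₂ := by
  obtain ⟨z, -, -, hu⟩ := exists_isCubicRootNear hp hq h₁.self hs
  have t₁ : Tendsto (fun w => (w, z₁ w)) (𝓝 y) (𝓝 (y, z₁ y)) :=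
    tendsto_id.prodMk_nhds h₁.1.continuousAt
  have t₂ : Tendsto (fun w => (w, z₂ w)) (𝓝 y) (𝓝 (y, z₁ y)) :=
    h ▸ tendsto_id.prodMk_nhds h₂.1.continuousAt
  filter_upwards [t₁.eventually hu, t₂.eventually hu, h₁.2, h₂.2] with w a b c d
  exact (a c).trans (b d).symm

theorem fderiv_cubic_root {p q z : ℂ × ℂ → ℂ} {y : ℂ × ℂ} (hp : AnalyticAt ℂ p y)
    (hq : AnalyticAt ℂ q y) (hz : IsCubicRootNear p q z y) (v : ℂ × ℂ) :
    (3 * z y ^ 2 - p y) * fderiv ℂ z y v = fderiv ℂ p y v * z y + fderiv ℂ q y v := by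
  have h1 := (hz.1.differentiableAt.hasFDerivAt.pow 3)
  have h2 := (hp.differentiableAt.hasFDerivAt.mul hz.1.differentiableAt.hasFDerivAt).add
    hq.differentiableAt.hasFDerivAt
  have h3 := h1.congr_of_eventuallyEq (hz.2.mono fun w hw => hw.symm)
  have := congrArg (fun L => L v) (h2.unique h3)
  simp at this
  linear_combination -this

/-- The coefficients of `1`, `z`, `z ^ 2` in `(3 z ^ 2 - p) (u_t - u u_x)` for `u = a + z`,
`z ^ 3 = p z + q`. -/
noncomputable def coeffZero (a p q : ℂ × ℂ → ℂ) (w : ℂ × ℂ) : ℂ :=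
  timeDeriv q w - a w * spaceDeriv q w - 3 * q w * spaceDeriv a w
    - p w * (timeDeriv a w - a w * spaceDeriv a w)

/-- The coefficient of `z` in `(3 z ^ 2 - p) (u_t - u u_x)`. -/
noncomputable def coeffOne (a p q : ℂ × ℂ → ℂ) (w : ℂ × ℂ) : ℂ :=
  timeDeriv p w - a w * spaceDeriv p w - 2 * p w * spaceDeriv a w - spaceDeriv q w

/-- The coefficient of `z ^ 2` in `(3 z ^ 2 - p) (u_t - u u_x)`. -/
noncomputable def coeffTwo (a p : ℂ × ℂ → ℂ) (w : ℂ × ℂ) : ℂ :=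
  3 * (timeDeriv a w - a w * spaceDeriv a w) - spaceDeriv p w

theorem analyticAt_timeDeriv {f : ℂ × ℂ → ℂ} {y : ℂ × ℂ} (hf : AnalyticAt ℂ f y) :
    AnalyticAt ℂ (timeDeriv f) y :=
  ((ContinuousLinearMap.apply ℂ ℂ ((1, 0) : ℂ × ℂ)).analyticAt _).comp hf.fderiv

theorem analyticAt_spaceDeriv {f : ℂ × ℂ → ℂ} {y : ℂ × ℂ} (hf : AnalyticAt ℂ f y) :
    AnalyticAt ℂ (spaceDeriv f) y :=
  ((ContinuousLinearMap.apply ℂ ℂ ((0, 1) : ℂ × ℂ)).analyticAt _).comp hf.fderiv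

section

variable {a p q : ℂ × ℂ → ℂ} {y : ℂ × ℂ}

theorem analyticAt_coeffZero (ha : AnalyticAt ℂ a y) (hp : AnalyticAt ℂ p y)
    (hq : AnalyticAt ℂ q y) : AnalyticAt ℂ (coeffZero a p q) y :=
  (((analyticAt_timeDeriv hq).sub (ha.mul (analyticAt_spaceDeriv hq))).sub
    ((analyticAt_const.mul hq).mul (analyticAt_spaceDeriv ha))).sub
    (hp.mul ((analyticAt_timeDeriv ha).sub (ha.mul (analyticAt_spaceDeriv ha))))

theorem analyticAt_coeffOne (ha : AnalyticAt ℂ a y) (hp : AnalyticAt ℂ p y)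
    (hq : AnalyticAt ℂ q y) : AnalyticAt ℂ (coeffOne a p q) y :=
  (((analyticAt_timeDeriv hp).sub (ha.mul (analyticAt_spaceDeriv hp))).sub
    ((analyticAt_const.mul hp).mul (analyticAt_spaceDeriv ha))).sub (analyticAt_spaceDeriv hq)

theorem analyticAt_coeffTwo (ha : AnalyticAt ℂ a y) (hp : AnalyticAt ℂ p y) :
    AnalyticAt ℂ (coeffTwo a p) y :=
  (analyticAt_const.mul ((analyticAt_timeDeriv ha).sub (ha.mul (analyticAt_spaceDeriv ha)))).sub
    (analyticAt_spaceDeriv hp)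

/-- Differentiating the cubic gives `(3 z ^ 2 - p) z_v = p_v z + q_v`; the powers of `z` above the
second are then reduced by the cubic itself. -/
theorem burgers_add_root {z : ℂ × ℂ → ℂ} (ha : AnalyticAt ℂ a y) (hp : AnalyticAt ℂ p y)
    (hq : AnalyticAt ℂ q y) (hz : IsCubicRootNear p q z y) :
    (3 * z y ^ 2 - p y) * (timeDeriv (fun w => a w + z w) y
        - (a y + z y) * spaceDeriv (fun w => a w + z w) y) =
      coeffZero a p q y + coeffOne a p q y * z y + coeffTwo a p y * z y ^ 2 := by
  have hd : fderiv ℂ (fun w => a w + z w) y = fderiv ℂ a y + fderiv ℂ z y :=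
    fderiv_fun_add ha.differentiableAt hz.1.differentiableAt
  have ht := fderiv_cubic_root hp hq hz (1, 0)
  have hx := fderiv_cubic_root hp hq hz (0, 1)
  have h := hz.self
  simp only [timeDeriv, spaceDeriv, coeffZero, coeffOne, coeffTwo, hd, add_apply]
  linear_combination ht - (a y + z y) * hx - 3 * fderiv ℂ a y (0, 1) * h

end

theorem IsCubicRootNear.eventually {p q z : ℂ × ℂ → ℂ} {y : ℂ × ℂ}
    (h : IsCubicRootNear p q z y) : ∀ᶠ w in 𝓝 y, IsCubicRootNear p q z w :=
  h.1.eventually_analyticAt.and (eventually_eventually_nhds.2 h.2)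

/-! ### Functional calculus and construction of `a`, `p`, `q` -/

/-- A holomorphic germ at `0 ∈ ℂ` acts on small elements of a complex Banach algebra; eigenvectors
for the powers of an element are eigenvectors for its image. -/
theorem exists_functionalCalculus {a₀ : ℂ → ℂ} (ha₀ : AnalyticAt ℂ a₀ 0) (A : Type*)
    [NormedRing A] [NormedAlgebra ℂ A] [CompleteSpace A] [NormOneClass A] :
    ∃ f : A → A, AnalyticAt ℂ f 0 ∧ ∃ r > 0, (∀ m, ‖m‖ < r → AnalyticAt ℂ a₀ m) ∧
      ∀ X : A, ‖X‖ < r → ∀ m : ℂ, ‖m‖ < r →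
        ∀ {V : Type} [NormedAddCommGroup V] [NormedSpace ℂ V] (L : A →L[ℂ] V),
          (∀ n : ℕ, L (X ^ n) = m ^ n • L 1) → L (f X) = a₀ m • L 1 := by
  obtain ⟨P, R, hP⟩ := ha₀
  obtain ⟨r, hr0, hrR⟩ := ENNReal.lt_iff_exists_nnreal_btwn.1 hP.r_pos
  set Q := FormalMultilinearSeries.ofScalars A P.coeff with hQ
  -- Since `‖1‖ = 1` in `A`, the coefficients have the same norms as those of the scalar series, and
  -- the same geometric bound applies.
  have hrQ : (r : ENNReal) ≤ Q.radius := by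
    obtain ⟨C, -, hC⟩ := P.norm_mul_pow_le_of_lt_radius (hrR.trans_le hP.r_le)
    refine Q.le_radius_of_bound C fun n => ?_
    rw [hQ, FormalMultilinearSeries.ofScalars_norm,
      ← FormalMultilinearSeries.norm_apply_eq_norm_coef]
    exact hC n
  have hmem : ∀ m : ℂ, ‖m‖ < r → m ∈ Metric.eball (0 : ℂ) R := fun m hm => by
    rw [Metric.mem_eball, edist_zero_right]
    refine lt_trans ?_ hrR
    rwa [← ofReal_norm, ENNReal.ofReal_lt_coe_iff (norm_nonneg _)]
  refine ⟨Q.sum, (Q.hasFPowerSeriesOnBall (hr0.trans_le hrQ)).analyticAt, r,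
    by exact_mod_cast hr0, fun m hm => hP.analyticAt_of_mem (hmem m hm), ?_⟩
  intro X hX m hm V _ _ L hL
  have hXm : X ∈ Metric.eball (0 : A) Q.radius := by
    rw [Metric.mem_eball, edist_zero_right]
    refine lt_of_lt_of_le ?_ hrQ
    rwa [← ofReal_norm, ENNReal.ofReal_lt_coe_iff (norm_nonneg _)]
  have h1 := L.hasSum (Q.hasSum hXm)
  have h2 := (hP.hasSum_sub (hmem m hm)).smul_const (L 1)
  refine h1.unique ?_
  convert h2 using 2 with n
  simp only [hQ, FormalMultilinearSeries.ofScalars_apply_eq, map_smul, hL, sub_zero,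
    FormalMultilinearSeries.apply_eq_pow_smul_coeff, smul_smul, smul_eq_mul]
  rw [mul_comm]

section CompanionMatrix

open scoped Matrix.Norms.Operator
open Matrix

/-- Companion matrix of `Z ^ 3 - p Z - q`, shifted by `a`. -/
def shiftedCompanion (c : ℂ × ℂ × ℂ) : Matrix (Fin 3) (Fin 3) ℂ :=
  c.1 • 1 + (!![0, 0, 0; 1, 0, 0; 0, 1, 0] + c.2.1 • !![0, 0, 0; 0, 0, 1; 0, 0, 0] +
    c.2.2 • !![0, 0, 1; 0, 0, 0; 0, 0, 0])

/-- Column `j` of the companion matrix holds the coordinates of `Z * Z ^ j` modulo the cubic;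
pairing with `(1, z, z ^ 2)` evaluates at `Z = z`. -/
theorem vecMul_shiftedCompanion (c : ℂ × ℂ × ℂ) {z : ℂ} (hz : z ^ 3 = c.2.1 * z + c.2.2) :
    ![1, z, z ^ 2] ᵥ* shiftedCompanion c = (c.1 + z) • ![1, z, z ^ 2] := by
  ext i
  fin_cases i <;>
    simp [shiftedCompanion, vecMul, dotProduct, Fin.sum_univ_three, Matrix.one_apply]
  · ring
  · linear_combination -hz

/-- The matrix form of `(u - a₀ (x + t u)) ^ 3 - (x + t u)` at `u = shiftedCompanion c`. -/
def implicitMatrix (f : Matrix (Fin 3) (Fin 3) ℂ → Matrix (Fin 3) (Fin 3) ℂ)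
    (v : (ℂ × ℂ) × (ℂ × ℂ × ℂ)) : Matrix (Fin 3) (Fin 3) ℂ :=
  (shiftedCompanion v.2 - f (v.1.2 • 1 + v.1.1 • shiftedCompanion v.2)) ^ 3 -
    (v.1.2 • 1 + v.1.1 • shiftedCompanion v.2)

/-- The first column of `implicitMatrix`. -/
def implicitColumn (f : Matrix (Fin 3) (Fin 3) ℂ → Matrix (Fin 3) (Fin 3) ℂ)
    (v : (ℂ × ℂ) × (ℂ × ℂ × ℂ)) : ℂ × ℂ × ℂ :=
  (implicitMatrix f v 0 0, implicitMatrix f v 1 0, implicitMatrix f v 2 0)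

theorem analyticAt_shiftedCompanion (c : ℂ × ℂ × ℂ) : AnalyticAt ℂ shiftedCompanion c := by
  have h1 : AnalyticAt ℂ (fun c : ℂ × ℂ × ℂ => c.2.1) c := analyticAt_fst.fun_comp analyticAt_snd
  have h2 : AnalyticAt ℂ (fun c : ℂ × ℂ × ℂ => c.2.2) c := analyticAt_snd.fun_comp analyticAt_snd
  exact (analyticAt_fst.smul analyticAt_const).add ((analyticAt_const.add
    (h1.smul analyticAt_const)).add (h2.smul analyticAt_const))

theorem analyticAt_matrix_entry (i j : Fin 3) (X : Matrix (Fin 3) (Fin 3) ℂ) :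
    AnalyticAt ℂ (fun Y : Matrix (Fin 3) (Fin 3) ℂ => Y i j) X :=
  (LinearMap.toContinuousLinearMap (Matrix.entryLinearMap ℂ ℂ i j)).analyticAt X

theorem analyticAt_implicitMatrix {f : Matrix (Fin 3) (Fin 3) ℂ → Matrix (Fin 3) (Fin 3) ℂ}
    (hf : AnalyticAt ℂ f 0) (c : ℂ × ℂ × ℂ) :
    AnalyticAt ℂ (implicitMatrix f) ((0, 0), c) := by
  have hs : AnalyticAt ℂ (fun v : (ℂ × ℂ) × (ℂ × ℂ × ℂ) => shiftedCompanion v.2) ((0, 0), c) :=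
    AnalyticAt.fun_comp (f := Prod.snd) (analyticAt_shiftedCompanion c) analyticAt_snd
  have hX : AnalyticAt ℂ (fun v : (ℂ × ℂ) × (ℂ × ℂ × ℂ) =>
      v.1.2 • (1 : Matrix (Fin 3) (Fin 3) ℂ) + v.1.1 • shiftedCompanion v.2) ((0, 0), c) := by
    have h1 : AnalyticAt ℂ (fun v : (ℂ × ℂ) × (ℂ × ℂ × ℂ) => v.1.1) ((0, 0), c) :=
      analyticAt_fst.fun_comp analyticAt_fst
    have h2 : AnalyticAt ℂ (fun v : (ℂ × ℂ) × (ℂ × ℂ × ℂ) => v.1.2) ((0, 0), c) :=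
      analyticAt_snd.fun_comp analyticAt_fst
    exact (h2.smul analyticAt_const).add (h1.smul hs)
  have hfX : AnalyticAt ℂ (fun v : (ℂ × ℂ) × (ℂ × ℂ × ℂ) =>
      f (v.1.2 • (1 : Matrix (Fin 3) (Fin 3) ℂ) + v.1.1 • shiftedCompanion v.2)) ((0, 0), c) :=
    AnalyticAt.fun_comp (by simpa using hf) hX
  exact ((hs.sub hfX).pow 3).sub hX

theorem analyticAt_implicitColumn {f : Matrix (Fin 3) (Fin 3) ℂ → Matrix (Fin 3) (Fin 3) ℂ}
    (hf : AnalyticAt ℂ f 0) (c : ℂ × ℂ × ℂ) :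
    AnalyticAt ℂ (implicitColumn f) ((0, 0), c) := by
  have h := analyticAt_implicitMatrix hf c
  exact ((analyticAt_matrix_entry 0 0 _).fun_comp h).prod
    (((analyticAt_matrix_entry 1 0 _).fun_comp h).prod
      ((analyticAt_matrix_entry 2 0 _).fun_comp h))

/-- For `t = 0` the relation is polynomial in the companion matrix, and the column lists the
coefficients of `1`, `Z`, `Z ^ 2` of `(c.1 - b + Z) ^ 3 - x` modulo the cubic. This yields both the
linearisation at the origin and the initial values. -/
theorem implicitColumn_of_time_eq_zero
    {f : Matrix (Fin 3) (Fin 3) ℂ → Matrix (Fin 3) (Fin 3) ℂ} {x b : ℂ}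
    (hf : f (x • 1) = b • 1) (c : ℂ × ℂ × ℂ) :
    implicitColumn f ((0, x), c) =
      ((c.1 - b) ^ 3 + c.2.2 - x, 3 * (c.1 - b) ^ 2 + c.2.1, 3 * (c.1 - b)) := by
  have h : implicitMatrix f ((0, x), c) = (shiftedCompanion (c.1 - b, c.2)) ^ 3 - x • 1 := by
    simp only [implicitMatrix, zero_smul, add_zero, hf]
    congr 2
    simp only [shiftedCompanion, sub_smul]
    abel
  simp only [implicitColumn, h]
  simp [shiftedCompanion, pow_succ, Matrix.mul_apply, Fin.sum_univ_three, Matrix.one_apply]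
  constructor <;> ring

/-- A bound uniform over the roots, needed to keep `x + t (a + z)` inside the disc where the power
series of `a₀` converges. -/
theorem norm_cubic_root_le_one {p q z : ℂ} (h : z ^ 3 = p * z + q) (hpq : ‖p‖ + ‖q‖ < 1) :
    ‖z‖ ≤ 1 := by
  by_contra! hz
  have h1 : ‖z‖ ^ 3 ≤ ‖p‖ * ‖z‖ + ‖q‖ := by
    rw [← norm_pow, h, ← norm_mul]
    exact norm_add_le _ _
  nlinarith [norm_nonneg p, norm_nonneg q, mul_pos (sub_pos.2 hz) (sub_pos.2 hz),
    mul_nonneg (norm_nonneg q) (sub_pos.2 hz).le, mul_pos (lt_trans one_pos hz) (sub_pos.2 hz)]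

/-- There are holomorphic `a`, `p`, `q` near the origin such that for all roots `z` of
`z ^ 3 = p z + q`, `u = a + z` satisfies the implicit equation `(u - a₀ (x + t u)) ^ 3 = x + t u`. -/
theorem exists_coefficients {a₀ : ℂ → ℂ} (ha₀ : AnalyticAt ℂ a₀ 0) :
    ∃ a p q : ℂ × ℂ → ℂ, AnalyticAt ℂ a (0, 0) ∧ AnalyticAt ℂ p (0, 0) ∧ AnalyticAt ℂ q (0, 0) ∧
      (∀ᶠ x in 𝓝 (0 : ℂ), a (0, x) = a₀ x ∧ p (0, x) = 0 ∧ q (0, x) = x) ∧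
      ∀ᶠ w in 𝓝 ((0, 0) : ℂ × ℂ), ∀ z : ℂ, z ^ 3 = p w * z + q w →
        AnalyticAt ℂ a₀ (w.2 + w.1 * (a w + z)) ∧
        (a w + z - a₀ (w.2 + w.1 * (a w + z))) ^ 3 = w.2 + w.1 * (a w + z) := by
  obtain ⟨f, hf, r, hr, han, hL⟩ := exists_functionalCalculus ha₀ (Matrix (Fin 3) (Fin 3) ℂ)
  have hfx : ∀ x : ℂ, ‖x‖ < r → f (x • 1) = a₀ x • 1 := fun x hx =>
    hL (x • 1) (by simpa [norm_smul] using hx) x hx (.id ℂ _) (by simp [smul_pow])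
  have hΦ := analyticAt_implicitColumn hf (a₀ 0, 0, 0)
  have hf0 : f ((0 : ℂ) • 1) = a₀ 0 • 1 := hfx 0 (by simpa using hr)
  have hΦ0 : implicitColumn f ((0, 0), (a₀ 0, 0, 0)) = 0 := by
    simp [implicitColumn_of_time_eq_zero hf0]
  -- In the unknowns `(a, p, q)` the linearisation at the origin reverses the order of the
  -- coordinates and multiplies one of them by 3, so it is injective.
  obtain ⟨g, hg, hg0, hgΦ, hgu⟩ := exists_analyticAt_implicit hΦ (fun v hv => by
    have hd : HasDerivAt (fun s : ℂ => implicitColumn f ((0, 0), (a₀ 0, 0, 0) + s • v))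
        (v.2.2, v.2.1, 3 * v.1) 0 := by
      simp only [implicitColumn_of_time_eq_zero hf0]
      have e : ∀ k : ℂ, HasDerivAt (fun s : ℂ => s * k) k 0 := fun k => by
        simpa using (hasDerivAt_id (0 : ℂ)).mul_const k
      have h3 := ((e v.1).pow 3).add (e v.2.2)
      have h2 := (((e v.1).pow 2).const_mul 3).add (e v.2.1)
      have h1 := (e v.1).const_mul 3
      convert h3.prodMk (h2.prodMk h1) using 1
      · ext s <;> simp
      · simp
    rw [fderiv_apply_inr hΦ.differentiableAt hd] at hv
    simp only [Prod.mk_eq_zero, mul_eq_zero, OfNat.ofNat_ne_zero, false_or] at hv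
    exact Prod.ext hv.2.2 (Prod.ext hv.2.1 hv.1))
  rw [hΦ0] at hgΦ hgu
  have ha : AnalyticAt ℂ (fun w => (g w).1) (0, 0) := analyticAt_fst.fun_comp hg
  have hp : AnalyticAt ℂ (fun w => (g w).2.1) (0, 0) :=
    analyticAt_fst.fun_comp (analyticAt_snd.fun_comp hg)
  have hq : AnalyticAt ℂ (fun w => (g w).2.2) (0, 0) :=
    analyticAt_snd.fun_comp (analyticAt_snd.fun_comp hg)
  refine ⟨fun w => (g w).1, fun w => (g w).2.1, fun w => (g w).2.2, ha, hp, hq, ?_, ?_⟩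
  -- For `t = 0` the triple `(a₀ x, 0, x)` solves the system, so local uniqueness makes it the value
  -- of `g`.
  · have ht : Tendsto (fun x : ℂ => (((0, x), (a₀ x, 0, x)) : (ℂ × ℂ) × (ℂ × ℂ × ℂ)))
        (𝓝 0) (𝓝 ((0, 0), (a₀ 0, 0, 0))) :=
      (tendsto_const_nhds.prodMk_nhds tendsto_id).prodMk_nhds
        (ha₀.continuousAt.tendsto.prodMk_nhds (tendsto_const_nhds.prodMk_nhds tendsto_id))
    filter_upwards [ht.eventually hgu, Metric.ball_mem_nhds (0 : ℂ) hr] with x hx hxr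
    have := hx (by simp [implicitColumn_of_time_eq_zero (hfx x (by simpa using hxr))])
    simp [← this]
  · have hpq : ∀ᶠ w in 𝓝 ((0, 0) : ℂ × ℂ), ‖(g w).2.1‖ + ‖(g w).2.2‖ < 1 := by
      refine (hp.continuousAt.norm.add hq.continuousAt.norm).eventually_lt
        continuousAt_const ?_
      simp [hg0]
    have hm : ∀ᶠ w in 𝓝 ((0, 0) : ℂ × ℂ), ‖w.2‖ + ‖w.1‖ * (‖(g w).1‖ + 1) < r := by
      refine (continuousAt_snd.norm.add (continuousAt_fst.norm.mul
        (ha.continuousAt.norm.add continuousAt_const))).eventually_lt continuousAt_const ?_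
      simpa using hr
    have hX : ∀ᶠ w in 𝓝 ((0, 0) : ℂ × ℂ),
        ‖w.2 • (1 : Matrix (Fin 3) (Fin 3) ℂ) + w.1 • shiftedCompanion (g w)‖ < r := by
      have hc : ContinuousAt (fun w => shiftedCompanion (g w)) ((0, 0) : ℂ × ℂ) :=
        ((analyticAt_shiftedCompanion _).fun_comp hg).continuousAt
      refine ((continuousAt_snd.smul continuousAt_const).add
        (continuousAt_fst.smul hc)).norm.eventually_lt continuousAt_const ?_
      simpa using hr
    filter_upwards [hgΦ, hpq, hm, hX] with w hw hpq hm hX z hz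
    have hz1 := norm_cubic_root_le_one hz hpq
    set u := (g w).1 + z with hu
    set m := w.2 + w.1 * u with hm_def
    have hmr : ‖m‖ < r := by
      refine lt_of_le_of_lt ((norm_add_le _ _).trans ?_) hm
      rw [norm_mul]
      gcongr
      exact (norm_add_le _ _).trans (by gcongr)
    refine ⟨han m hmr, ?_⟩
    set X := w.2 • (1 : Matrix (Fin 3) (Fin 3) ℂ) + w.1 • shiftedCompanion (g w) with hX_def
    set l : Fin 3 → ℂ := ![1, z, z ^ 2] with hl
    have hlY : l ᵥ* shiftedCompanion (g w) = u • l := vecMul_shiftedCompanion (g w) hz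
    have hlX : l ᵥ* X = m • l := by
      rw [hX_def, vecMul_add, vecMul_smul, vecMul_smul, hlY, vecMul_one, smul_smul, ← add_smul]
    have hpow : ∀ (Y : Matrix (Fin 3) (Fin 3) ℂ) (k : ℂ), l ᵥ* Y = k • l →
        ∀ n : ℕ, l ᵥ* (Y ^ n) = k ^ n • l := by
      intro Y k h n
      induction n with
      | zero => simp
      | succ n ih => rw [pow_succ, ← vecMul_vecMul, ih, smul_vecMul, h, smul_smul, pow_succ]
    let Λ : Matrix (Fin 3) (Fin 3) ℂ →L[ℂ] (Fin 3 → ℂ) := LinearMap.toContinuousLinearMap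
      { toFun := fun Y => l ᵥ* Y
        map_add' := fun Y Z => vecMul_add Y Z l
        map_smul' := fun k Y => vecMul_smul l k Y }
    have hΛ : l ᵥ* f X = a₀ m • l := by
      have := hL X hX m hmr Λ (fun n => by
        change l ᵥ* (X ^ n) = m ^ n • (l ᵥ* 1)
        rw [hpow X m hlX, vecMul_one])
      change l ᵥ* f X = a₀ m • (l ᵥ* 1) at this
      rwa [vecMul_one] at this
    have hfin : l ᵥ* implicitMatrix f (w, g w) = ((u - a₀ m) ^ 3 - m) • l := by
      change l ᵥ* ((shiftedCompanion (g w) - f X) ^ 3 - X) = _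
      rw [vecMul_sub, hlX, hpow _ (u - a₀ m) (by rw [vecMul_sub, hlY, hΛ, sub_smul]), sub_smul]
    -- The first column suffices: entry 0 of the eigenvector identity involves only this column,
    -- which is zero, and `l 0 = 1`.
    have h0 := congrFun hfin 0
    simp only [implicitColumn, Prod.mk_eq_zero] at hw
    simp only [vecMul, dotProduct, Fin.sum_univ_three, hw.1, hw.2.1, hw.2.2, mul_zero, add_zero,
      Pi.smul_apply, smul_eq_mul] at h0
    have hl0 : l 0 = 1 := rfl
    rw [hl0, mul_one] at h0
    exact sub_eq_zero.1 h0.symm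

end CompanionMatrix

/-! ### Implicit solutions, characteristics and uniqueness for the equation -/

/-- Holomorphic functions given implicitly by `(u - a₀ (x + t u)) ^ 3 = x + t u` solve
`u_t = u u_x`. -/
theorem burgers_of_implicit {a₀ : ℂ → ℂ} {u : ℂ × ℂ → ℂ} {y : ℂ × ℂ} (hu : AnalyticAt ℂ u y)
    (h : ∀ᶠ w in 𝓝 y, (u w - a₀ (w.2 + w.1 * u w)) ^ 3 = w.2 + w.1 * u w)
    (ha₀ : AnalyticAt ℂ a₀ (y.2 + y.1 * u y)) :
    timeDeriv u y - u y * spaceDeriv u y = 0 := by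
  have hξ := (hasFDerivAt_snd (𝕜 := ℂ) (p := y)).add
    ((hasFDerivAt_fst (𝕜 := ℂ) (p := y)).mul hu.differentiableAt.hasFDerivAt)
  have hE := hu.differentiableAt.hasFDerivAt.sub
    (ha₀.differentiableAt.hasDerivAt.comp_hasFDerivAt y hξ)
  have hE3 := hE.pow 3
  have hd := (hξ.congr_of_eventuallyEq h).unique hE3
  have key : ∀ v : ℂ × ℂ, 3 * (u y - a₀ (y.2 + y.1 * u y)) ^ 2 *
      (fderiv ℂ u y v - deriv a₀ (y.2 + y.1 * u y) * (v.2 + (y.1 * fderiv ℂ u y v + u y * v.1))) =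
      v.2 + (y.1 * fderiv ℂ u y v + u y * v.1) := by
    intro v
    have := congrArg (fun L => L v) hd
    simp at this
    linear_combination -this
  have ht := key (1, 0)
  have hx := key (0, 1)
  simp only [timeDeriv, spaceDeriv]
  generalize fderiv ℂ u y (1, 0) = ut at *
  generalize fderiv ℂ u y (0, 1) = ux at *
  generalize deriv a₀ (y.2 + y.1 * u y) = α at *
  generalize 3 * (u y - a₀ (y.2 + y.1 * u y)) ^ 2 = k at *
  -- If the first factor were zero, the `x`-derivative of the relation would give `1 + k α = 0`,
  -- hence `k = 0`, a contradiction.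
  have hδ : (k - y.1 * (1 + k * α)) * (ut - u y * ux) = 0 := by
    linear_combination ht - u y * hx
  refine (mul_eq_zero.1 hδ).resolve_left fun h0 => ?_
  have h1 : 1 + k * α = 0 := by linear_combination -hx + ux * h0
  have hk : k = 0 := by linear_combination h0 + y.1 * h1
  simp [hk] at h1

/-- Solutions of `u_t = u u_x` are constant along the lines `x = ξ - t u(0, ξ)`. -/
theorem SolvesBurgersNear.const_along_characteristics {v : ℂ × ℂ → ℂ} {x₀ : ℂ} {g : ℂ → ℂ}
    (hv : SolvesBurgersNear v (0, x₀)) (hg : ContinuousAt g x₀)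
    (hvg : ∀ᶠ x in 𝓝 x₀, v (0, x) = g x) :
    ∀ᶠ c in 𝓝 ((0, x₀) : ℂ × ℂ), v (c.1, c.2 - c.1 * g c.2) = g c.2 := by
  obtain ⟨K, hK⟩ : ∃ K, ∀ᶠ w in 𝓝 ((0, x₀) : ℂ × ℂ), ‖spaceDeriv v w‖ ≤ K :=
    ⟨‖spaceDeriv v (0, x₀)‖ + 1, ((analyticAt_spaceDeriv hv.1).continuousAt.norm.eventually_lt
      continuousAt_const (lt_add_one _)).mono fun _ h => h.le⟩
  obtain ⟨ε, hε, hball⟩ := Metric.eventually_nhds_iff_ball.1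
    (hv.1.eventually_analyticAt.and (hv.2.and hK))
  have hg2 : ContinuousAt (fun c : ℂ × ℂ => g c.2) (0, x₀) :=
    ContinuousAt.comp (f := Prod.snd) hg continuousAt_snd
  have t1 : Tendsto (fun c : ℂ × ℂ => (c.1, c.2 - c.1 * g c.2)) (𝓝 (0, x₀)) (𝓝 (0, x₀)) := by
    have : ContinuousAt (fun c : ℂ × ℂ => (c.1, c.2 - c.1 * g c.2)) (0, x₀) :=
      continuousAt_fst.prodMk (continuousAt_snd.sub (continuousAt_fst.mul hg2))
    simpa [ContinuousAt] using this
  have t0 : Tendsto (fun c : ℂ × ℂ => ((0, c.2) : ℂ × ℂ)) (𝓝 (0, x₀)) (𝓝 (0, x₀)) := by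
    have : ContinuousAt (fun c : ℂ × ℂ => ((0, c.2) : ℂ × ℂ)) (0, x₀) :=
      continuousAt_const.prodMk continuousAt_snd
    simpa [ContinuousAt] using this
  have ht : ∀ᶠ c in 𝓝 ((0, x₀) : ℂ × ℂ), ‖c.1‖ < 1 :=
    continuousAt_fst.norm.eventually_lt continuousAt_const (by simp)
  have h0 : ∀ᶠ c in 𝓝 ((0, x₀) : ℂ × ℂ), v (0, c.2) = g c.2 :=
    (continuousAt_snd : Tendsto Prod.snd (𝓝 ((0, x₀) : ℂ × ℂ)) (𝓝 x₀)).eventually hvg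
  filter_upwards [t1.eventually (Metric.ball_mem_nhds _ hε),
    t0.eventually (Metric.ball_mem_nhds _ hε), ht, h0] with c hc1 hc0 hct hc
  set l : ℝ → ℂ × ℂ := fun r => (r * c.1, c.2 - r * c.1 * g c.2) with hl
  have hlmem : ∀ r ∈ Set.Icc (0 : ℝ) 1, l r ∈ Metric.ball ((0, x₀) : ℂ × ℂ) ε := by
    intro r hr
    have := (convex_ball ((0, x₀) : ℂ × ℂ) ε) hc0 hc1 (sub_nonneg.2 hr.2) hr.1 (by ring)
    convert this using 1
    ext <;> simp [hl]
    ring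
  have hld : ∀ r : ℝ, HasDerivAt l (c.1, -(c.1 * g c.2)) r := by
    intro r
    have h1 : HasDerivAt (fun r : ℝ => (r : ℂ)) 1 r := Complex.ofRealCLM.hasDerivAt
    have h2 : HasDerivAt (fun r : ℝ => (r : ℂ) * c.1) c.1 r := by simpa using h1.mul_const c.1
    exact h2.prodMk ((h2.mul_const (g c.2)).const_sub c.2)
  -- By the equation, `v - g` satisfies a homogeneous linear differential equation along the segment
  -- with zero initial value; Grönwall's inequality makes it vanish.
  have hder : ∀ r ∈ Set.Icc (0 : ℝ) 1, HasDerivAt (fun r => v (l r) - g c.2)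
      (c.1 * spaceDeriv v (l r) * (v (l r) - g c.2)) r := by
    intro r hr
    obtain ⟨han, hb, -⟩ := hball _ (hlmem r hr)
    have := ((han.differentiableAt.hasFDerivAt.restrictScalars ℝ).comp_hasDerivAt r
      (hld r)).sub_const (g c.2)
    refine HasDerivAt.congr_deriv this ?_
    have e : ((c.1, -(c.1 * g c.2)) : ℂ × ℂ) =
        c.1 • ((1, 0) : ℂ × ℂ) + (-(c.1 * g c.2)) • ((0, 1) : ℂ × ℂ) := by
      ext <;> simp
    simp only [timeDeriv, spaceDeriv] at hb ⊢
    rw [ContinuousLinearMap.coe_restrictScalars', e, map_add, map_smul, map_smul, smul_eq_mul,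
      smul_eq_mul]
    linear_combination c.1 * hb
  have := norm_le_gronwallBound_of_norm_deriv_right_le (δ := 0) (K := K) (ε := 0)
    (fun r hr => (hder r hr).continuousAt.continuousWithinAt)
    (fun r hr => (hder r (Set.Ico_subset_Icc_self hr)).hasDerivWithinAt)
    (by simp [hl, hc]) (fun r hr => by
      obtain ⟨-, -, hb⟩ := hball _ (hlmem r (Set.Ico_subset_Icc_self hr))
      rw [norm_mul, norm_mul, add_zero]
      gcongr
      calc ‖c.1‖ * ‖spaceDeriv v (l r)‖ ≤ 1 * ‖spaceDeriv v (l r)‖ := by gcongr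
        _ ≤ K := by simpa using hb) 1 (Set.right_mem_Icc.2 zero_le_one)
  rw [gronwallBound_ε0_δ0, norm_le_zero_iff, sub_eq_zero] at this
  simpa [hl] using this

/-- Uniqueness of the holomorphic solution of `u_t = u u_x` with given initial values. -/
theorem SolvesBurgersNear.eventuallyEq {v₁ v₂ : ℂ × ℂ → ℂ} {x₀ : ℂ}
    (h₁ : SolvesBurgersNear v₁ (0, x₀)) (h₂ : SolvesBurgersNear v₂ (0, x₀))
    (h : ∀ᶠ x in 𝓝 x₀, v₁ (0, x) = v₂ (0, x)) : v₁ =ᶠ[𝓝 (0, x₀)] v₂ := by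
  set g : ℂ → ℂ := fun x => v₁ (0, x) with hg_def
  have hg : AnalyticAt ℂ g x₀ := AnalyticAt.fun_comp h₁.1 (analyticAt_const.prod analyticAt_id)
  set F : (ℂ × ℂ) × ℂ → ℂ := fun c => c.2 - c.1.1 * g c.2 - c.1.2 with hF_def
  have hF : AnalyticAt ℂ F ((0, x₀), x₀) := by
    have e₁ : AnalyticAt ℂ (fun c : (ℂ × ℂ) × ℂ => c.1.1) ((0, x₀), x₀) :=
      analyticAt_fst.fun_comp analyticAt_fst
    have e₂ : AnalyticAt ℂ (fun c : (ℂ × ℂ) × ℂ => c.1.2) ((0, x₀), x₀) :=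
      analyticAt_snd.fun_comp analyticAt_fst
    have e₃ : AnalyticAt ℂ (fun c : (ℂ × ℂ) × ℂ => g c.2) ((0, x₀), x₀) :=
      AnalyticAt.fun_comp (f := Prod.snd) hg analyticAt_snd
    exact (analyticAt_snd.sub (e₁.mul e₃)).sub e₂
  have hF0 : F ((0, x₀), x₀) = 0 := by simp [hF_def]
  -- `ξ w` is the foot of the characteristic through `w`; the derivative of `ξ - t g ξ - x` in `ξ`
  -- is 1 at `t = 0`.
  obtain ⟨ξ, hξ, hξ0, hξF, -⟩ := exists_analyticAt_implicit hF (fun k hk => by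
    have hd : HasDerivAt (fun s : ℂ => F ((0, x₀), x₀ + s • k)) k 0 := by
      simpa [hF_def] using (((hasDerivAt_id (0 : ℂ)).mul_const k).const_add x₀).sub_const x₀
    rwa [fderiv_apply_inr hF.differentiableAt hd] at hk)
  have ht : Tendsto (fun w : ℂ × ℂ => (w.1, ξ w)) (𝓝 (0, x₀)) (𝓝 (0, x₀)) := by
    have : ContinuousAt (fun w : ℂ × ℂ => (w.1, ξ w)) (0, x₀) :=
      continuousAt_fst.prodMk hξ.continuousAt
    simpa [ContinuousAt, hξ0] using this
  have c₁ := h₁.const_along_characteristics hg.continuousAt (Eventually.of_forall fun _ => rfl)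
  have c₂ := h₂.const_along_characteristics hg.continuousAt (h.mono fun _ h => h.symm)
  filter_upwards [ht.eventually c₁, ht.eventually c₂, hξF] with w e₁ e₂ hw
  have hx : ξ w - w.1 * g (ξ w) = w.2 := by
    rw [hF0] at hw
    exact sub_eq_zero.1 hw
  simp only [hx] at e₁ e₂
  exact e₁.trans e₂.symm

/-! ### The norm argument: one branch determines the system -/

/-- The norm of `A + B z + C z ^ 2`, where `z ^ 3 = p z + q`. -/
def cubicNorm (p q A B C : ℂ) : ℂ :=
  A * (A ^ 2 + 2 * A * C * p + C ^ 2 * p ^ 2 - B ^ 2 * p - 3 * B * C * q) +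
    q * (B ^ 3 - p * B * C ^ 2 + C ^ 3 * q)

/-- The multiplier is the product of the two conjugate factors: the other roots have sum `-z` and
product `z ^ 2 - p`. -/
theorem cubicNorm_eq_zero_of_root {p q A B C z : ℂ} (hz : z ^ 3 = p * z + q)
    (h : A + B * z + C * z ^ 2 = 0) : cubicNorm p q A B C = 0 := by
  have hq : q = z ^ 3 - p * z := by linear_combination -hz
  subst hq
  unfold cubicNorm
  linear_combination (A ^ 2 - A * B * z + A * C * (2 * p - z ^ 2) + B ^ 2 * (z ^ 2 - p)
    - B * C * z * (z ^ 2 - p) + C ^ 2 * (z ^ 2 - p) ^ 2) * h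

theorem exists_eq_id_mul {f : ℂ → ℂ} (hf : AnalyticAt ℂ f 0) (h0 : f 0 = 0) :
    ∃ g, AnalyticAt ℂ g 0 ∧ ∀ᶠ x in 𝓝 (0 : ℂ), f x = x * g x := by
  have h1 : ((1 : ℕ) : ℕ∞) ≤ analyticOrderAt f 0 := by
    rw [Nat.cast_one, Order.one_le_iff_ne_zero]
    exact hf.analyticOrderAt_ne_zero.2 h0
  obtain ⟨g, hg, h⟩ := (natCast_le_analyticOrderAt hf).1 h1
  exact ⟨g, hg, h.mono fun x hx => by simpa using hx⟩

theorem eventually_eq_zero_of_pow_mul {f : ℂ → ℂ} (hf : AnalyticAt ℂ f 0) (n : ℕ)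
    (h : ∀ᶠ x in 𝓝 (0 : ℂ), x ^ n * f x = 0) : ∀ᶠ x in 𝓝 (0 : ℂ), f x = 0 := by
  refine hf.frequently_zero_iff_eventually_zero.1 (Eventually.frequently ?_)
  filter_upwards [h.filter_mono nhdsWithin_le_nhds, self_mem_nhdsWithin] with x hx hx0
  exact (mul_eq_zero.1 hx).resolve_left (pow_ne_zero _ hx0)

/-- Eisenstein's argument: the leading terms `A ^ 3`, `q B ^ 3`, `q ^ 2 C ^ 3` have orders in
distinct classes modulo 3. Dividing the norm successively by `1`, `x`, `x ^ 2` isolates `A 0`, `B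
0`, `C 0`. -/
theorem apply_eq_zero_of_cubicNorm_eq_zero {p q : ℂ → ℂ} (hp : AnalyticAt ℂ p 0)
    (hq : AnalyticAt ℂ q 0) (hp0 : p 0 = 0) (hq0 : q 0 = 0) (hq' : deriv q 0 ≠ 0)
    {A B C : ℂ → ℂ} (hA : AnalyticAt ℂ A 0)
    (hB : AnalyticAt ℂ B 0) (hC : AnalyticAt ℂ C 0)
    (hN : ∀ᶠ x in 𝓝 (0 : ℂ), cubicNorm (p x) (q x) (A x) (B x) (C x) = 0) :
    A 0 = 0 ∧ B 0 = 0 ∧ C 0 = 0 := by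
  obtain ⟨p₁, hp₁, ep⟩ := exists_eq_id_mul hp hp0
  obtain ⟨q₁, hq₁, eq⟩ := exists_eq_id_mul hq hq0
  have hq₁0 : q₁ 0 ≠ 0 := by
    have h : HasDerivAt q (q₁ 0) 0 := by
      have := (hasDerivAt_id (0 : ℂ)).mul hq₁.differentiableAt.hasDerivAt
      simpa using this.congr_of_eventuallyEq eq
    rwa [← h.deriv]
  have hA0 : A 0 = 0 := by
    have := hN.self_of_nhds
    simpa [cubicNorm, hp0, hq0, ← pow_succ'] using this
  obtain ⟨A₁, hA₁, eA⟩ := exists_eq_id_mul hA hA0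
  have hB0 : B 0 = 0 := by
    have h := eventually_eq_zero_of_pow_mul (f := fun x =>
      A₁ x * (A x ^ 2 + 2 * A x * C x * p x + C x ^ 2 * p x ^ 2 - B x ^ 2 * p x
        - 3 * B x * C x * q x) + q₁ x * (B x ^ 3 - p x * B x * C x ^ 2 + C x ^ 3 * q x))
      (by fun_prop) 1 (by
        filter_upwards [hN, eA, eq] with x hN eA eq
        unfold cubicNorm at hN
        linear_combination hN - (A x ^ 2 + 2 * A x * C x * p x + C x ^ 2 * p x ^ 2
          - B x ^ 2 * p x - 3 * B x * C x * q x) * eA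
          - (B x ^ 3 - p x * B x * C x ^ 2 + C x ^ 3 * q x) * eq)
    simpa [hA0, hp0, hq0, hq₁0] using h.self_of_nhds
  obtain ⟨B₁, hB₁, eB⟩ := exists_eq_id_mul hB hB0
  refine ⟨hA0, hB0, ?_⟩
  have h := eventually_eq_zero_of_pow_mul (f := fun x =>
    x * A₁ x * (A₁ x ^ 2 + 2 * A₁ x * C x * p₁ x + C x ^ 2 * p₁ x ^ 2 - x * B₁ x ^ 2 * p₁ x
      - 3 * B₁ x * C x * q₁ x)
      + q₁ x * (x ^ 2 * B₁ x ^ 3 - x * p₁ x * B₁ x * C x ^ 2 + C x ^ 3 * q₁ x))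
    (by fun_prop) 2 (by
      filter_upwards [hN, eA, eB, ep, eq] with x hN eA eB ep eq
      rw [eA, eB, ep, eq, cubicNorm] at hN
      linear_combination hN)
  simpa [hq₁0] using h.self_of_nhds

/-- If `q` vanishes to order one and `p` vanishes, the polynomial `Z ^ 3 - p Z - q` is irreducible
over the germs of meromorphic functions: elements of norm zero vanish. -/
theorem eventually_eq_zero_of_cubicNorm_eq_zero {p q : ℂ → ℂ} (hp : AnalyticAt ℂ p 0)
    (hq : AnalyticAt ℂ q 0) (hp0 : p 0 = 0) (hq0 : q 0 = 0) (hq' : deriv q 0 ≠ 0)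
    {A B C : ℂ → ℂ} (hA : AnalyticAt ℂ A 0)
    (hB : AnalyticAt ℂ B 0) (hC : AnalyticAt ℂ C 0)
    (hN : ∀ᶠ x in 𝓝 (0 : ℂ), cubicNorm (p x) (q x) (A x) (B x) (C x) = 0) :
    ∀ᶠ x in 𝓝 (0 : ℂ), A x = 0 ∧ B x = 0 ∧ C x = 0 := by
  -- Infinite descent: the norm is homogeneous of degree 3, so removing a factor `x` from each of
  -- `A`, `B`, `C` leaves a triple of norm zero.
  have key : ∀ n : ℕ, ∀ A B C : ℂ → ℂ, AnalyticAt ℂ A 0 → AnalyticAt ℂ B 0 → AnalyticAt ℂ C 0 →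
      (∀ᶠ x in 𝓝 (0 : ℂ), cubicNorm (p x) (q x) (A x) (B x) (C x) = 0) →
      (n : ℕ∞) ≤ analyticOrderAt A 0 ∧ (n : ℕ∞) ≤ analyticOrderAt B 0 ∧
        (n : ℕ∞) ≤ analyticOrderAt C 0 := by
    intro n
    induction n with
    | zero => intros; simp
    | succ n ih =>
      intro A B C hA hB hC hN
      obtain ⟨hA0, hB0, hC0⟩ :=
        apply_eq_zero_of_cubicNorm_eq_zero hp hq hp0 hq0 hq' hA hB hC hN
      obtain ⟨A₁, hA₁, eA⟩ := exists_eq_id_mul hA hA0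
      obtain ⟨B₁, hB₁, eB⟩ := exists_eq_id_mul hB hB0
      obtain ⟨C₁, hC₁, eC⟩ := exists_eq_id_mul hC hC0
      have hN₁ := eventually_eq_zero_of_pow_mul
        (f := fun x => cubicNorm (p x) (q x) (A₁ x) (B₁ x) (C₁ x))
        (by unfold cubicNorm; fun_prop) 3 (by
          filter_upwards [hN, eA, eB, eC] with x hN eA eB eC
          rw [eA, eB, eC] at hN
          unfold cubicNorm at hN ⊢
          linear_combination hN)
      have step : ∀ {f g : ℂ → ℂ}, AnalyticAt ℂ f 0 → AnalyticAt ℂ g 0 →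
          (∀ᶠ x in 𝓝 (0 : ℂ), f x = x * g x) → (n : ℕ∞) ≤ analyticOrderAt g 0 →
          ((n + 1 : ℕ) : ℕ∞) ≤ analyticOrderAt f 0 := by
        intro f g hf hg e h
        obtain ⟨k, hk, ek⟩ := (natCast_le_analyticOrderAt hg).1 h
        refine (natCast_le_analyticOrderAt hf).2 ⟨k, hk, ?_⟩
        filter_upwards [e, ek] with x e ek
        rw [e, ek, pow_succ]
        simp only [smul_eq_mul]
        ring
      obtain ⟨iA, iB, iC⟩ := ih A₁ B₁ C₁ hA₁ hB₁ hC₁ hN₁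
      exact ⟨step hA hA₁ eA iA, step hB hB₁ eB iB, step hC hC₁ eC iC⟩
  have top : ∀ f : ℂ → ℂ, (∀ n : ℕ, (n : ℕ∞) ≤ analyticOrderAt f 0) →
      ∀ᶠ x in 𝓝 (0 : ℂ), f x = 0 := fun f h =>
    analyticOrderAt_eq_top.1 (ENat.eq_top_iff_forall_ge.2 h)
  filter_upwards [top A fun n => (key n A B C hA hB hC hN).1,
    top B fun n => (key n A B C hA hB hC hN).2.1,
    top C fun n => (key n A B C hA hB hC hN).2.2] with x h1 h2 h3
  exact ⟨h1, h2, h3⟩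

/-- An analytic germ vanishing on an open cone of lines through the origin is zero. -/
theorem eventually_eq_zero_of_lines {f : ℂ × ℂ → ℂ} (hf : AnalyticAt ℂ f 0) {v₀ : ℂ × ℂ}
    (h : ∀ᶠ v in 𝓝 v₀, ∀ᶠ τ in 𝓝 (0 : ℂ), f (τ • v) = 0) : ∀ᶠ w in 𝓝 0, f w = 0 := by
  obtain ⟨R, hR, hball⟩ := Metric.eventually_nhds_iff_ball.1 hf.eventually_analyticAt
  have hτ : ∀ᶠ τ in 𝓝[≠] (0 : ℂ), τ • v₀ ∈ Metric.ball (0 : ℂ × ℂ) R := by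
    have : Tendsto (fun τ : ℂ => τ • v₀) (𝓝[≠] 0) (𝓝 0) := by
      have : ContinuousAt (fun τ : ℂ => τ • v₀) 0 := by fun_prop
      simpa [ContinuousAt] using this.tendsto.mono_left nhdsWithin_le_nhds
    exact this.eventually (Metric.ball_mem_nhds _ hR)
  obtain ⟨τ₀, hτ₀, hτ₀0⟩ := (hτ.and self_mem_nhdsWithin).exists
  have hτ₀0 : τ₀ ≠ 0 := hτ₀0
  -- Points near `τ₀ • v₀` lie on lines with direction near `v₀`; the identity theorem on each line
  -- carries the vanishing from `τ = 0` to `τ = τ₀`.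
  have hnear : f =ᶠ[𝓝 (τ₀ • v₀)] 0 := by
    have ht : Tendsto (fun w : ℂ × ℂ => τ₀⁻¹ • w) (𝓝 (τ₀ • v₀)) (𝓝 v₀) := by
      have : ContinuousAt (fun w : ℂ × ℂ => τ₀⁻¹ • w) (τ₀ • v₀) := by fun_prop
      simpa [ContinuousAt, smul_smul, hτ₀0] using this
    filter_upwards [ht.eventually h, Metric.isOpen_ball.mem_nhds hτ₀] with w hw hwR
    set v := τ₀⁻¹ • w with hv
    have hτv : τ₀ • v = w := by simp [hv, smul_smul, hτ₀0]
    set T : Set ℂ := (fun τ : ℂ => τ • v) ⁻¹' Metric.ball (0 : ℂ × ℂ) R with hT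
    have hconv : Convex ℝ T :=
      (convex_ball (0 : ℂ × ℂ) R).is_linear_preimage
        ⟨fun a b => add_smul a b v, fun c a => smul_assoc c a v⟩
    have han : AnalyticOnNhd ℂ (fun τ : ℂ => f (τ • v)) T := fun τ hτ =>
      AnalyticAt.fun_comp (hball _ hτ) (analyticAt_id.smul analyticAt_const)
    have := han.eqOn_zero_of_preconnected_of_eventuallyEq_zero hconv.isPreconnected
      (z₀ := 0) (by simp [hT, hR]) hw
    have h1 := this (x := τ₀) (by simpa [hT, hτv] using hwR)
    simpa [hτv] using h1
  have hz := AnalyticOnNhd.eqOn_zero_of_preconnected_of_eventuallyEq_zero (f := f)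
    (fun w hw => hball w hw) (convex_ball (0 : ℂ × ℂ) R).isPreconnected hτ₀ hnear
  filter_upwards [Metric.ball_mem_nhds (0 : ℂ × ℂ) hR] with w hw
  exact hz hw

/-- On every line through the origin with direction near `(0, 1)`, `q` has a simple zero, so the
one-variable result applies there. -/
theorem eventually_coeff_eq_zero {p q A B C : ℂ × ℂ → ℂ} (hp : AnalyticAt ℂ p 0)
    (hq : AnalyticAt ℂ q 0) (hA : AnalyticAt ℂ A 0) (hB : AnalyticAt ℂ B 0)
    (hC : AnalyticAt ℂ C 0) (hp0 : p 0 = 0) (hq0 : q 0 = 0) (hq' : fderiv ℂ q 0 (0, 1) ≠ 0)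
    (hN : ∀ᶠ w in 𝓝 0, cubicNorm (p w) (q w) (A w) (B w) (C w) = 0) :
    ∀ᶠ w in 𝓝 0, A w = 0 ∧ B w = 0 ∧ C w = 0 := by
  have hv : ∀ᶠ v in 𝓝 ((0, 1) : ℂ × ℂ), fderiv ℂ q 0 v ≠ 0 :=
    (fderiv ℂ q 0).continuous.continuousAt.eventually_ne hq'
  have hline : ∀ v : ℂ × ℂ, fderiv ℂ q 0 v ≠ 0 →
      ∀ᶠ τ in 𝓝 (0 : ℂ), A (τ • v) = 0 ∧ B (τ • v) = 0 ∧ C (τ • v) = 0 := by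
    intro v hv
    have hl : AnalyticAt ℂ (fun τ : ℂ => τ • v) 0 := analyticAt_id.smul analyticAt_const
    have comp : ∀ {f : ℂ × ℂ → ℂ}, AnalyticAt ℂ f 0 → AnalyticAt ℂ (fun τ : ℂ => f (τ • v)) 0 :=
      fun hf => AnalyticAt.fun_comp (by simpa using hf) hl
    have ht : Tendsto (fun τ : ℂ => τ • v) (𝓝 0) (𝓝 0) := by
      simpa [ContinuousAt] using hl.continuousAt
    refine eventually_eq_zero_of_cubicNorm_eq_zero (comp hp) (comp hq) (by simpa using hp0)
      (by simpa using hq0) ?_ (comp hA) (comp hB) (comp hC) (ht.eventually hN)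
    have hd : HasDerivAt (fun τ : ℂ => q (τ • v)) (fderiv ℂ q 0 v) 0 := by
      have h1 : HasDerivAt (fun τ : ℂ => τ • v) v 0 := by
        simpa using (hasDerivAt_id (0 : ℂ)).smul_const v
      have h2 : HasFDerivAt q (fderiv ℂ q 0) ((fun τ : ℂ => τ • v) 0) := by
        simpa using hq.differentiableAt.hasFDerivAt
      exact h2.comp_hasDerivAt (0 : ℂ) h1
    rwa [hd.deriv]
  filter_upwards [eventually_eq_zero_of_lines hA (hv.mono fun v h => (hline v h).mono fun _ h => h.1),
    eventually_eq_zero_of_lines hB (hv.mono fun v h => (hline v h).mono fun _ h => h.2.1),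
    eventually_eq_zero_of_lines hC (hv.mono fun v h => (hline v h).mono fun _ h => h.2.2)]
    with w h1 h2 h3
  exact ⟨h1, h2, h3⟩

/-! ### The covering by roots and analytic continuation -/

theorem exists_openPartialHomeomorph {F : Type*} [NormedAddCommGroup F] [NormedSpace ℂ F]
    [FiniteDimensional ℂ F] {f : F → F} {y : F} (hf : AnalyticAt ℂ f y)
    (hker : ∀ v, fderiv ℂ f y v = 0 → v = 0) :
    ∃ φ : OpenPartialHomeomorph F F, y ∈ φ.source ∧ (φ : F → F) = f := by
  have : CompleteSpace F := FiniteDimensional.complete ℂ F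
  obtain ⟨e, he⟩ := isInvertible_of_ker_eq_zero (fderiv ℂ f y) hker
  have hd : HasFDerivAt f (e : F →L[ℂ] F) y := he ▸ hf.differentiableAt.hasFDerivAt
  have hn : (1 : WithTop ℕ∞) ≠ 0 := one_ne_zero
  exact ⟨ContDiffAt.toOpenPartialHomeomorph f (hf.contDiffAt (n := 1)) hd hn,
    ContDiffAt.mem_toOpenPartialHomeomorph_source _ hd hn, rfl⟩

theorem three_mul_sq_ne_of_discr_ne_zero {P Q ζ : ℂ} (h : ζ ^ 3 = P * ζ + Q)
    (hD : 4 * P ^ 3 - 27 * Q ^ 2 ≠ 0) : 3 * ζ ^ 2 ≠ P := by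
  rintro rfl
  have hQ : Q = -2 * ζ ^ 3 := by linear_combination -h
  exact hD (by rw [hQ]; ring)

/-- The surface of triples `(P, Q, z)` with `z ^ 3 = P z + Q`, in coordinates `(P, z)`,
projected to `(P, Q)`. -/
def rootProjection (v : ℂ × ℂ) : ℂ × ℂ := (v.1, v.2 ^ 3 - v.1 * v.2)

theorem analyticAt_rootProjection (v : ℂ × ℂ) : AnalyticAt ℂ rootProjection v :=
  analyticAt_fst.prod ((analyticAt_snd.pow 3).sub (analyticAt_fst.mul analyticAt_snd))

theorem fderiv_rootProjection (v w : ℂ × ℂ) :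
    fderiv ℂ rootProjection v w = (w.1, (3 * v.2 ^ 2 - v.1) * w.2 - v.2 * w.1) := by
  have h1 := hasFDerivAt_fst (𝕜 := ℂ) (p := v)
  have h2 := hasFDerivAt_snd (𝕜 := ℂ) (p := v)
  have h : HasFDerivAt rootProjection _ v := h1.prodMk ((h2.pow 3).sub (h1.mul h2))
  rw [h.fderiv]
  ext
  · simp
  · simp
    ring

theorem isProperMap_rootProjection : IsProperMap rootProjection := by
  have hc : Continuous rootProjection := by unfold rootProjection; fun_prop
  refine isProperMap_iff_isCompact_preimage.2 ⟨hc, fun K hK => ?_⟩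
  refine Metric.isCompact_of_isClosed_isBounded (hK.isClosed.preimage hc) ?_
  obtain ⟨R, hR⟩ := hK.isBounded.exists_norm_le
  refine isBounded_iff_forall_norm_le.2 ⟨2 * R + 1, fun v hv => ?_⟩
  have h := hR _ hv
  have h1 : ‖v.1‖ ≤ R := (norm_fst_le (rootProjection v)).trans h
  have h2 : ‖v.2 ^ 3 - v.1 * v.2‖ ≤ R := (norm_snd_le (rootProjection v)).trans h
  have hR0 : 0 ≤ R := (norm_nonneg _).trans h1
  refine max_le (by linarith) ?_
  by_contra! hlt
  have h3 : ‖v.2‖ ^ 3 ≤ R + R * ‖v.2‖ := by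
    calc ‖v.2‖ ^ 3 = ‖(v.2 ^ 3 - v.1 * v.2) + v.1 * v.2‖ := by rw [sub_add_cancel, norm_pow]
      _ ≤ R + R * ‖v.2‖ := (norm_add_le _ _).trans (by rw [norm_mul]; gcongr)
  have h4 : 1 ≤ ‖v.2‖ := by linarith
  have h5 : ‖v.2‖ * (2 * R + 1) < ‖v.2‖ * ‖v.2‖ := by gcongr
  nlinarith

/-- Off the discriminant the projection is a local homeomorphism by the inverse function theorem.
Properness makes it closed, and makes the discrete fibres compact, hence finite. -/
theorem isCoveringMapOn_rootProjection :
    IsCoveringMapOn rootProjection {c | 4 * c.1 ^ 3 - 27 * c.2 ^ 2 ≠ 0} := by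
  have hloc : ∀ e ∈ rootProjection ⁻¹' {c | 4 * c.1 ^ 3 - 27 * c.2 ^ 2 ≠ 0},
      ∃ φ : OpenPartialHomeomorph (ℂ × ℂ) (ℂ × ℂ),
        e ∈ φ.source ∧ (φ : ℂ × ℂ → ℂ × ℂ) = rootProjection := by
    intro e he
    have hs : 3 * e.2 ^ 2 ≠ e.1 := three_mul_sq_ne_of_discr_ne_zero
      (Q := (rootProjection e).2) (by simp [rootProjection]) he
    refine exists_openPartialHomeomorph (analyticAt_rootProjection e) fun w hw => ?_
    rw [fderiv_rootProjection, Prod.mk_eq_zero] at hw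
    obtain ⟨h1, h2⟩ := hw
    rw [h1, mul_zero, sub_zero, mul_eq_zero] at h2
    exact Prod.ext h1 (h2.resolve_left (sub_ne_zero.2 hs))
  refine isProperMap_rootProjection.isClosedMap.isCoveringMapOn_of_isLocalHomeomorphOn
    (fun x hx => ?_) (fun e he => ?_)
  · refine (isProperMap_rootProjection.isCompact_preimage isCompact_singleton).finite
      (IsDiscrete.of_openPartialHomeomorph rootProjection subset_rfl fun e he => hloc e ?_)
    rw [Set.mem_preimage, Set.mem_singleton_iff.1 he]
    exact hx
  · obtain ⟨φ, h1, h2⟩ := hloc e he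
    exact ⟨φ, h1, h2.symm⟩

/-- Roots of the cubic can be followed continuously where the discriminant does not vanish. -/
theorem exists_continuous_root {P Q : unitInterval → ℂ} (hP : Continuous P) (hQ : Continuous Q)
    (hD : ∀ s, 4 * P s ^ 3 - 27 * Q s ^ 2 ≠ 0) {ζ₀ : ℂ} (h0 : ζ₀ ^ 3 = P 0 * ζ₀ + Q 0) :
    ∃ ζ : unitInterval → ℂ, Continuous ζ ∧ ζ 0 = ζ₀ ∧ ∀ s, ζ s ^ 3 = P s * ζ s + Q s := by
  set T : Set (ℂ × ℂ) := {c | 4 * c.1 ^ 3 - 27 * c.2 ^ 2 ≠ 0} with hT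
  have he : rootProjection (P 0, ζ₀) = (P 0, Q 0) := by
    ext
    · rfl
    · change ζ₀ ^ 3 - P 0 * ζ₀ = Q 0
      linear_combination h0
  have hmem : rootProjection (P 0, ζ₀) ∈ T := he ▸ hD 0
  obtain ⟨F, hF, hF0⟩ :=
    isCoveringMapOn_rootProjection.isCoveringMap_restrictPreimage.exists_path_lifts
      (⟨fun s => ⟨(P s, Q s), hD s⟩, by fun_prop⟩ : C(unitInterval, T)) ⟨(P 0, ζ₀), hmem⟩
      (Subtype.ext he.symm)
  refine ⟨fun s => (F s).1.2, by fun_prop, by simp [hF0], fun s => ?_⟩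
  have h : rootProjection (F s).1 = (P s, Q s) := congrArg Subtype.val (congrFun hF s)
  have h1 : (F s).1.1 = P s := congrArg Prod.fst h
  have h2 : (F s).1.2 ^ 3 - (F s).1.1 * (F s).1.2 = Q s := congrArg Prod.snd h
  rw [h1] at h2
  linear_combination h2

/-- A continuous family of simple roots along a path gives an analytic continuation. -/
theorem exists_continuation_of_roots {a p q : ℂ × ℂ → ℂ} {y₀ y₁ : ℂ × ℂ} (γ : Path y₀ y₁)
    (ha : ∀ s, AnalyticAt ℂ a (γ s)) (hp : ∀ s, AnalyticAt ℂ p (γ s))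
    (hq : ∀ s, AnalyticAt ℂ q (γ s)) (hD : ∀ s, discr p q (γ s) ≠ 0) {ζ : unitInterval → ℂ}
    (hζc : Continuous ζ) (hζ : ∀ s, ζ s ^ 3 = p (γ s) * ζ s + q (γ s)) :
    ∃ z : unitInterval → ℂ × ℂ → ℂ, (∀ s, IsCubicRootNear p q (z s) (γ s) ∧ z s (γ s) = ζ s) ∧
      IsContinuationAlong γ (fun s w => a w + z s w) := by
  have hs : ∀ s, 3 * ζ s ^ 2 ≠ p (γ s) := fun s => three_mul_sq_ne_of_discr_ne_zero (hζ s) (hD s)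
  choose z hz hzv hzu using fun s => exists_isCubicRootNear (hp s) (hq s) (hζ s) (hs s)
  refine ⟨z, fun s => ⟨hz s, hzv s⟩, fun s => (ha s).add (hz s).1, fun s => ?_⟩
  have ht : Tendsto (fun r => (γ r, ζ r)) (𝓝 s) (𝓝 (γ s, ζ s)) :=
    (γ.continuous.tendsto s).prodMk_nhds (hζc.tendsto s)
  filter_upwards [ht.eventually (hzu s), (γ.continuous.tendsto s).eventually (hz s).eventually]
    with r hr hroot
  have he : z r =ᶠ[𝓝 (γ r)] z s := eventuallyEq_of_cubic_root (hp r) (hq r) (hz r) hroot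
    ((hzv r).trans (hr (hζ r))) (by rw [hzv r]; exact hs r)
  exact he.mono fun w hw => by simp only [hw]

/-! ### Configurations of roots and monodromy around the cusp -/

/-- The coefficients `(P, Q)` of the cubic `Z ^ 3 - P Z - Q` with roots `z₁`, `z₂`, `-z₁ - z₂`. -/
def cubicOfRoots (v : ℂ × ℂ) : ℂ × ℂ :=
  (v.1 ^ 2 + v.1 * v.2 + v.2 ^ 2, -(v.1 * v.2 * (v.1 + v.2)))

/-- The product of the differences of `z₁`, `z₂`, `-z₁ - z₂`. -/
def rootDifferences (v : ℂ × ℂ) : ℂ := (v.1 - v.2) * (2 * v.1 + v.2) * (v.1 + 2 * v.2)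

theorem discr_cubicOfRoots (v : ℂ × ℂ) :
    4 * (cubicOfRoots v).1 ^ 3 - 27 * (cubicOfRoots v).2 ^ 2 = rootDifferences v ^ 2 := by
  simp only [cubicOfRoots, rootDifferences]
  ring

theorem root_cubicOfRoots (v : ℂ × ℂ) :
    v.1 ^ 3 = (cubicOfRoots v).1 * v.1 + (cubicOfRoots v).2 := by
  simp only [cubicOfRoots]
  ring

theorem continuous_cubicOfRoots : Continuous cubicOfRoots := by
  unfold cubicOfRoots
  fun_prop

theorem exists_cubicOfRoots_eq {P Q z : ℂ} (h : z ^ 3 = P * z + Q) :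
    ∃ z' : ℂ, cubicOfRoots (z, z') = (P, Q) := by
  -- `4 P - 3 z ^ 2` is the discriminant of `z' ^ 2 + z z' + z ^ 2 - P`, the quadratic satisfied by
  -- the other roots.
  obtain ⟨s, hs⟩ := IsAlgClosed.exists_pow_nat_eq (4 * P - 3 * z ^ 2) two_pos
  have hP : z ^ 2 + z * ((s - z) / 2) + ((s - z) / 2) ^ 2 = P := by
    linear_combination hs / 4
  refine ⟨(s - z) / 2, Prod.ext hP ?_⟩
  simp only [cubicOfRoots]
  linear_combination h - z * hP

theorem cubicOfRoots_smul (c : ℂ) (v : ℂ × ℂ) :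
    cubicOfRoots (c • v) = (c ^ 2 * (cubicOfRoots v).1, c ^ 3 * (cubicOfRoots v).2) := by
  simp only [cubicOfRoots, Prod.smul_fst, Prod.smul_snd, smul_eq_mul]
  ext <;> simp <;> ring

theorem rootDifferences_smul (c : ℂ) (v : ℂ × ℂ) :
    rootDifferences (c • v) = c ^ 3 * rootDifferences v := by
  simp only [rootDifferences, Prod.smul_fst, Prod.smul_snd, smul_eq_mul]
  ring

theorem norm_cubicOfRoots_smul_le {c : ℂ} (hc : ‖c‖ ≤ 1) (v : ℂ × ℂ) :
    ‖cubicOfRoots (c • v)‖ ≤ ‖c‖ * ‖cubicOfRoots v‖ := by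
  rw [cubicOfRoots_smul]
  have h2 : ‖c‖ ^ 2 ≤ ‖c‖ := pow_le_of_le_one (norm_nonneg _) hc two_ne_zero
  have h3 : ‖c‖ ^ 3 ≤ ‖c‖ := pow_le_of_le_one (norm_nonneg _) hc three_ne_zero
  refine max_le ?_ ?_
  · simp only [norm_mul, norm_pow]
    gcongr
    exact norm_fst_le _
  · simp only [norm_mul, norm_pow]
    gcongr
    exact norm_snd_le _

/-- The bad set is a union of three complex lines. The complex line through `A` and `B` meets it in
a countable set of parameters, and the complement of a countable set in `ℂ` is path connected. -/
theorem joinedIn_rootDifferences_ne_zero {A B : ℂ × ℂ} (hA : rootDifferences A ≠ 0)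
    (hB : rootDifferences B ≠ 0) : JoinedIn {v | rootDifferences v ≠ 0} A B := by
  have hcount : ∀ k d : ℂ, k ≠ 0 → {c : ℂ | k + c * d = 0}.Countable := by
    intro k d hk
    refine (Set.countable_singleton (-k / d)).mono fun c hc => ?_
    have hd : d ≠ 0 := by
      rintro rfl
      exact hk (by simpa using hc)
    rw [Set.mem_singleton_iff, eq_div_iff hd]
    have hc' : k + c * d = 0 := hc
    linear_combination hc'
  set D := B - A with hD
  have hsplit := hA
  simp only [rootDifferences, mul_ne_zero_iff] at hsplit
  obtain ⟨⟨h1, h2⟩, h3⟩ := hsplit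
  have hbad : {c : ℂ | rootDifferences (A + c • D) = 0}.Countable := by
    refine (((hcount _ (D.1 - D.2) h1).union (hcount _ (2 * D.1 + D.2) h2)).union
      (hcount _ (D.1 + 2 * D.2) h3)).mono fun c hc => ?_
    simp only [rootDifferences, Set.mem_ofPred_eq, mul_eq_zero, Prod.fst_add, Prod.snd_add,
      Prod.smul_fst, Prod.smul_snd, smul_eq_mul] at hc
    rcases hc with (hc | hc) | hc
    · exact Or.inl (Or.inl (by rw [Set.mem_ofPred_eq]; linear_combination hc))
    · exact Or.inl (Or.inr (by rw [Set.mem_ofPred_eq]; linear_combination hc))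
    · exact Or.inr (by rw [Set.mem_ofPred_eq]; linear_combination hc)
  have hconn := hbad.isPathConnected_compl_of_one_lt_rank (by simp)
  obtain ⟨η, hη⟩ := hconn.joinedIn 0 (by simpa using hA) 1 (by simpa [hD] using hB)
  have hcont : Continuous fun c : ℂ => A + c • D := by fun_prop
  refine ⟨(η.map hcont).cast (by simp) (by simp [hD]), fun s => hη s⟩

/-- The configurations of three distinct roots whose coefficients lie in a ball are connected. -/
theorem joinedIn_rootDifferences_ne_zero_ball {ρ : ℝ} {A B : ℂ × ℂ}
    (hA : rootDifferences A ≠ 0) (hB : rootDifferences B ≠ 0)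
    (hAρ : ‖cubicOfRoots A‖ < ρ) (hBρ : ‖cubicOfRoots B‖ < ρ) :
    JoinedIn {v | rootDifferences v ≠ 0 ∧ ‖cubicOfRoots v‖ < ρ} A B := by
  have hρ : 0 < ρ := (norm_nonneg _).trans_lt hAρ
  obtain ⟨η, hη⟩ := joinedIn_rootDifferences_ne_zero hA hB
  obtain ⟨K, hK⟩ := (isCompact_range (continuous_cubicOfRoots.comp η.continuous)).isBounded
    |>.exists_norm_le
  have hK' : ∀ s, ‖cubicOfRoots (η s)‖ ≤ K := fun s => hK _ ⟨s, rfl⟩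
  have hK0 : 0 ≤ K := (norm_nonneg _).trans (hK' 0)
  -- Scaling by `r` brings the whole path `η` into the ball; the endpoints are joined to their
  -- scaled copies radially.
  obtain ⟨r, hr0, hr1, hrK⟩ : ∃ r : ℝ, 0 < r ∧ r ≤ 1 ∧ r * K < ρ := by
    refine ⟨min 1 (ρ / (K + 1)), by positivity, min_le_left _ _, ?_⟩
    calc min 1 (ρ / (K + 1)) * K ≤ ρ / (K + 1) * K := by gcongr; exact min_le_right _ _
      _ < ρ := by
        rw [div_mul_eq_mul_div, div_lt_iff₀ (by positivity)]
        nlinarith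
  have hshrink : ∀ C : ℂ × ℂ, rootDifferences C ≠ 0 → ‖cubicOfRoots C‖ < ρ →
      JoinedIn {v | rootDifferences v ≠ 0 ∧ ‖cubicOfRoots v‖ < ρ} C ((r : ℂ) • C) := by
    intro C hC hCρ
    have hk : ∀ s : unitInterval, 0 < 1 - (s : ℝ) * (1 - r) ∧ 1 - (s : ℝ) * (1 - r) ≤ 1 := by
      intro s
      have h0 := s.2.1
      have h1 := s.2.2
      constructor <;> nlinarith
    refine ⟨⟨⟨fun s => ((1 - (s : ℝ) * (1 - r) : ℝ) : ℂ) • C, by fun_prop⟩, by simp, by simp⟩,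
      fun s => ?_⟩
    obtain ⟨k0, k1⟩ := hk s
    change rootDifferences (((1 - (s : ℝ) * (1 - r) : ℝ) : ℂ) • C) ≠ 0 ∧
      ‖cubicOfRoots (((1 - (s : ℝ) * (1 - r) : ℝ) : ℂ) • C)‖ < ρ
    generalize 1 - (s : ℝ) * (1 - r) = k at k0 k1 ⊢
    have hn : ‖(k : ℂ)‖ ≤ 1 := by rwa [Complex.norm_real, Real.norm_of_nonneg k0.le]
    refine ⟨?_, ?_⟩
    · rw [rootDifferences_smul]
      exact mul_ne_zero (pow_ne_zero _ (by exact_mod_cast k0.ne')) hC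
    · exact ((norm_cubicOfRoots_smul_le hn C).trans
        (mul_le_of_le_one_left (norm_nonneg _) hn)).trans_lt hCρ
  have hmid : JoinedIn {v | rootDifferences v ≠ 0 ∧ ‖cubicOfRoots v‖ < ρ}
      ((r : ℂ) • A) ((r : ℂ) • B) := by
    refine ⟨η.map (f := fun v => (r : ℂ) • v) (by fun_prop), fun s => ⟨?_, ?_⟩⟩
    · change rootDifferences ((r : ℂ) • η s) ≠ 0
      rw [rootDifferences_smul]
      exact mul_ne_zero (pow_ne_zero _ (by exact_mod_cast hr0.ne')) (hη s)
    · have hn : ‖(r : ℂ)‖ = r := by rw [Complex.norm_real, Real.norm_of_nonneg hr0.le]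
      refine (norm_cubicOfRoots_smul_le (by rw [hn]; exact hr1) (η s)).trans_lt ?_
      rw [hn]
      exact (mul_le_mul_of_nonneg_left (hK' s) hr0.le).trans_lt hrK
  exact (hshrink A hA hAρ).trans (hmid.trans (hshrink B hB hBρ).symm)

/-- Analytic continuation preserves the property of being `a` plus a root of the cubic. -/
theorem IsContinuationAlong.isCubicRootNear {a p q : ℂ × ℂ → ℂ} {y₀ y₁ : ℂ × ℂ} {γ : Path y₀ y₁}
    {f : unitInterval → ℂ × ℂ → ℂ} (hf : IsContinuationAlong γ f)
    (ha : ∀ s, AnalyticAt ℂ a (γ s)) (hp : ∀ s, AnalyticAt ℂ p (γ s))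
    (hq : ∀ s, AnalyticAt ℂ q (γ s)) (h0 : IsCubicRootNear p q (fun w => f 0 w - a w) y₀)
    (s : unitInterval) : IsCubicRootNear p q (fun w => f s w - a w) (γ s) := by
  -- On a ball where `G` is analytic, vanishing of its germ does not depend on the point. The
  -- property is thus locally constant in `s`, and the unit interval is connected.
  have key : ∀ s, ∀ᶠ r in 𝓝 s, IsCubicRootNear p q (fun w => f r w - a w) (γ r) ↔
      IsCubicRootNear p q (fun w => f s w - a w) (γ s) := by
    intro s
    set G : ℂ × ℂ → ℂ := fun w => (f s w - a w) ^ 3 - (p w * (f s w - a w) + q w) with hG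
    have hsa : AnalyticAt ℂ (fun w => f s w - a w) (γ s) := (hf.1 s).sub (ha s)
    have hGa : AnalyticAt ℂ G (γ s) := (hsa.pow 3).sub (((hp s).mul hsa).add (hq s))
    obtain ⟨R, hR, hball⟩ := Metric.eventually_nhds_iff_ball.1 hGa.eventually_analyticAt
    filter_upwards [hf.2 s, (γ.continuous.tendsto s).eventually (Metric.ball_mem_nhds _ hR)]
      with r hr hrR
    have hiff : IsCubicRootNear p q (fun w => f r w - a w) (γ r) ↔ G =ᶠ[𝓝 (γ r)] 0 := by
      constructor
      · rintro ⟨-, h⟩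
        filter_upwards [h, hr] with w hw e
        rw [e] at hw
        exact sub_eq_zero.2 hw
      · intro h
        refine ⟨(hf.1 r).sub (ha r), ?_⟩
        filter_upwards [h, hr] with w hw e
        rw [e]
        exact sub_eq_zero.1 hw
    have hident : ∀ {c d : ℂ × ℂ}, c ∈ Metric.ball (γ s) R → d ∈ Metric.ball (γ s) R →
        G =ᶠ[𝓝 c] 0 → G =ᶠ[𝓝 d] 0 := by
      intro c d hc hd h
      have hz := AnalyticOnNhd.eqOn_zero_of_preconnected_of_eventuallyEq_zero (f := G)
        (fun w hw => hball w hw) (convex_ball (γ s) R).isPreconnected hc h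
      filter_upwards [Metric.isOpen_ball.mem_nhds hd] with w hw
      exact hz hw
    rw [hiff]
    constructor
    · intro h
      exact ⟨hsa, (hident hrR (Metric.mem_ball_self hR) h).mono fun w hw => sub_eq_zero.1 hw⟩
    · rintro ⟨-, h⟩
      exact hident (Metric.mem_ball_self hR) hrR (h.mono fun w hw => sub_eq_zero.2 hw)
  set T : Set unitInterval := {s | IsCubicRootNear p q (fun w => f s w - a w) (γ s)} with hT
  have hclopen : IsClopen T := by
    refine ⟨⟨isOpen_iff_mem_nhds.2 fun s hs => ?_⟩, isOpen_iff_mem_nhds.2 fun s hs => ?_⟩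
    · filter_upwards [key s] with r hr h
      exact hs (hr.1 h)
    · filter_upwards [key s] with r hr
      exact hr.2 hs
  have hne : (0 : unitInterval) ∈ T := by simpa [hT] using h0
  have hsT : s ∈ T := by rw [hclopen.eq_univ ⟨0, hne⟩]; exact Set.mem_univ s
  exact hsT

theorem add_root_eventuallyEq {a p q z₁ z₂ : ℂ × ℂ → ℂ} {y : ℂ × ℂ} (hp : AnalyticAt ℂ p y)
    (hq : AnalyticAt ℂ q y) (hD : discr p q y ≠ 0) (h₁ : IsCubicRootNear p q z₁ y)
    (h₂ : IsCubicRootNear p q z₂ y) (h : z₁ y = z₂ y) :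
    (fun w => a w + z₁ w) =ᶠ[𝓝 y] fun w => a w + z₂ w :=
  (eventuallyEq_of_cubic_root hp hq h₁ h₂ h
    (three_mul_sq_ne_of_discr_ne_zero h₁.self hD)).mono fun w hw => by simp only [hw]

section Chart

variable {a p q : ℂ × ℂ → ℂ} {φ : OpenPartialHomeomorph (ℂ × ℂ) (ℂ × ℂ)} {ρ : ℝ}
  {U : Set (ℂ × ℂ)}

/-- In a chart given by `(p, q)`, paths of root configurations give paths off the cusp. -/
theorem exists_path_of_roots (hφ : ∀ y, φ y = (p y, q y)) (hρ : Metric.ball 0 ρ ⊆ φ.target)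
    (hU : U = φ.source ∩ φ ⁻¹' Metric.ball 0 ρ) {A B : ℂ × ℂ} (σ : Path A B)
    (hσ : ∀ s, rootDifferences (σ s) ≠ 0 ∧ ‖cubicOfRoots (σ s)‖ < ρ) :
    ∃ γ : Path (φ.symm (cubicOfRoots A)) (φ.symm (cubicOfRoots B)),
      (∀ s, γ s = φ.symm (cubicOfRoots (σ s))) ∧ (∀ s, γ s ∈ U \ cusp U p q) ∧
      (∀ s, discr p q (γ s) ≠ 0) ∧ ∀ s, (σ s).1 ^ 3 = p (γ s) * (σ s).1 + q (γ s) := by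
  have hball : ∀ s, cubicOfRoots (σ s) ∈ Metric.ball (0 : ℂ × ℂ) ρ := fun s => by
    simpa using (hσ s).2
  have hc : Continuous fun s => φ.symm (cubicOfRoots (σ s)) :=
    φ.continuousOn_symm.comp_continuous (continuous_cubicOfRoots.comp σ.continuous)
      fun s => hρ (hball s)
  have hpq : ∀ s, (p (φ.symm (cubicOfRoots (σ s))), q (φ.symm (cubicOfRoots (σ s)))) =
      cubicOfRoots (σ s) := fun s => by rw [← hφ, φ.right_inv (hρ (hball s))]
  have hp : ∀ s, p (φ.symm (cubicOfRoots (σ s))) = (cubicOfRoots (σ s)).1 :=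
    fun s => congrArg Prod.fst (hpq s)
  have hq : ∀ s, q (φ.symm (cubicOfRoots (σ s))) = (cubicOfRoots (σ s)).2 :=
    fun s => congrArg Prod.snd (hpq s)
  have hD : ∀ s, discr p q (φ.symm (cubicOfRoots (σ s))) ≠ 0 := fun s => by
    rw [discr, hp, hq, discr_cubicOfRoots]
    exact pow_ne_zero _ (hσ s).1
  refine ⟨⟨⟨fun s => φ.symm (cubicOfRoots (σ s)), hc⟩, by simp, by simp⟩, fun s => rfl,
    fun s => ⟨?_, fun h => hD s h.2⟩, hD, fun s => ?_⟩
  · rw [hU]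
    refine ⟨φ.map_target (hρ (hball s)), ?_⟩
    change φ (φ.symm (cubicOfRoots (σ s))) ∈ Metric.ball (0 : ℂ × ℂ) ρ
    rw [φ.right_inv (hρ (hball s))]
    exact hball s
  · change _ = p (φ.symm (cubicOfRoots (σ s))) * _ + q (φ.symm (cubicOfRoots (σ s)))
    rw [hp, hq]
    exact root_cubicOfRoots _

/-- The roots are then `ζ`, `ζ`, `-2 ζ`; for `P ≠ 0` the double one is `-3 Q / (2 P)`. -/
theorem exists_multiple_root {P Q : ℂ} (h : 4 * P ^ 3 - 27 * Q ^ 2 = 0) :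
    ∃ ζ : ℂ, P = 3 * ζ ^ 2 ∧ Q = -2 * ζ ^ 3 := by
  by_cases hP : P = 0
  · have hQ : Q = 0 := by simpa [hP] using h
    exact ⟨0, by simp [hP], by simp [hQ]⟩
  · have h1 : P = 3 * (-3 * Q / (2 * P)) ^ 2 := by
      field_simp
      linear_combination h
    refine ⟨-3 * Q / (2 * P), h1, ?_⟩
    have h2 : (-3 * Q / (2 * P)) ^ 3 = -3 * Q / (2 * P) * (P / 3) := by
      linear_combination -(-3 * Q / (2 * P) / 3) * h1
    rw [h2]
    field_simp

/-- In a chart given by `(p, q)`, the roots of `z ^ 3 = p z + q` are ramified around the cusp. -/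
theorem isRamifiedAround_cusp (hφ : ∀ y, φ y = (p y, q y)) (hρ : Metric.ball 0 ρ ⊆ φ.target)
    (hU : U = φ.source ∩ φ ⁻¹' Metric.ball 0 ρ) (ha : AnalyticOnNhd ℂ a U)
    (hp : AnalyticOnNhd ℂ p U) (hq : AnalyticOnNhd ℂ q U) {y₀ : ℂ × ℂ} (hy₀ : y₀ ∈ U)
    (hD₀ : discr p q y₀ ≠ 0) {z : ℂ × ℂ → ℂ} (hz : IsCubicRootNear p q z y₀) :
    IsRamifiedAround U (cusp U p q) y₀ (fun w => a w + z w) := by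
  refine ⟨fun y₁ γ hγ => ?_, fun y hy W hW => ?_⟩
  · have hD : ∀ s, discr p q (γ s) ≠ 0 := fun s h => (hγ s).2 ⟨(hγ s).1, h⟩
    obtain ⟨ζ, hζc, hζ0, hζ⟩ := exists_continuous_root (P := fun s => p (γ s))
      (Q := fun s => q (γ s)) (ζ₀ := z y₀)
      (continuous_iff_continuousAt.2 fun s =>
        (hp _ (hγ s).1).continuousAt.comp γ.continuous.continuousAt)
      (continuous_iff_continuousAt.2 fun s =>
        (hq _ (hγ s).1).continuousAt.comp γ.continuous.continuousAt)
      hD (by simpa using hz.self)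
    obtain ⟨Z, hZ, hcont⟩ := exists_continuation_of_roots γ (fun s => ha _ (hγ s).1)
      (fun s => hp _ (hγ s).1) (fun s => hq _ (hγ s).1) hD hζc hζ
    refine ⟨_, hcont, ?_⟩
    have hZ0 := hZ 0
    rw [γ.source] at hZ0
    exact add_root_eventuallyEq (hp _ hy₀) (hq _ hy₀) hD₀ hZ0.1 hz (hZ0.2.trans hζ0)
  · obtain ⟨ζ, hPζ, hQζ⟩ := exists_multiple_root hy.2
    have hyU := hy.1
    rw [hU] at hyU
    have hφy : φ y = (3 * ζ ^ 2, -2 * ζ ^ 3) := by rw [hφ, ← hPζ, ← hQζ]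
    -- The double root is split into `ζ + η` and `ζ - η` while the third stays at `-2 ζ`. The
    -- coefficients depend only on `η ^ 2`.
    have hcub : ∀ η : ℂ, cubicOfRoots (ζ + η, ζ - η) =
        (3 * ζ ^ 2 + η ^ 2, -2 * ζ ^ 3 + 2 * ζ * η ^ 2) := fun η => by
      simp only [cubicOfRoots]
      ext <;> simp <;> ring
    have hcont : Tendsto (fun η : ℂ => cubicOfRoots (ζ + η, ζ - η)) (𝓝 0) (𝓝 (φ y)) := by
      simp only [hcub]
      have : Continuous fun η : ℂ => (3 * ζ ^ 2 + η ^ 2, -2 * ζ ^ 3 + 2 * ζ * η ^ 2) := by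
        fun_prop
      simpa [hφy] using this.tendsto 0
    have hW' : ∀ᶠ η in 𝓝 (0 : ℂ), φ.symm (cubicOfRoots (ζ + η, ζ - η)) ∈ W := by
      have h1 := (φ.continuousAt_symm (φ.map_source hyU.1)).tendsto
      rw [φ.left_inv hyU.1] at h1
      exact (h1.comp hcont).eventually hW
    have hB : ∀ᶠ η in 𝓝 (0 : ℂ), ‖cubicOfRoots (ζ + η, ζ - η)‖ < ρ := by
      filter_upwards [hcont.eventually (Metric.isOpen_ball.mem_nhds hyU.2)] with η hη
      simpa using hη
    have hR : ∀ᶠ η in 𝓝 (0 : ℂ), η ≠ 0 → rootDifferences (ζ + η, ζ - η) ≠ 0 := by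
      have hform : ∀ η : ℂ, rootDifferences (ζ + η, ζ - η) = 2 * η * (9 * ζ ^ 2 - η ^ 2) :=
        fun η => by simp only [rootDifferences]; ring
      simp only [hform]
      by_cases hζ0 : ζ = 0
      · refine Eventually.of_forall fun η hη => ?_
        simp [hζ0, hη]
      · have h9 : ∀ᶠ η in 𝓝 (0 : ℂ), 9 * ζ ^ 2 - η ^ 2 ≠ 0 :=
          ContinuousAt.eventually_ne (by fun_prop) (by simp [hζ0])
        filter_upwards [h9] with η h9 hη
        exact mul_ne_zero (mul_ne_zero two_ne_zero hη) h9
    obtain ⟨δ, hδ, hall⟩ := Metric.eventually_nhds_iff_ball.1 (hW'.and (hB.and hR))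
    set ε : ℂ := ((δ / 2 : ℝ) : ℂ) with hε
    have hεn : ‖ε‖ = δ / 2 := by rw [hε, Complex.norm_real, Real.norm_of_nonneg (by positivity)]
    have hε0 : ε ≠ 0 := norm_pos_iff.1 (by rw [hεn]; positivity)
    have hgood : ∀ η : ℂ, ‖η‖ = δ / 2 → φ.symm (cubicOfRoots (ζ + η, ζ - η)) ∈ W ∧
        rootDifferences (ζ + η, ζ - η) ≠ 0 ∧ ‖cubicOfRoots (ζ + η, ζ - η)‖ < ρ := by
      intro η hη
      obtain ⟨h1, h2, h3⟩ := hall η (by simp [hη]; linarith)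
      exact ⟨h1, h3 (norm_pos_iff.1 (by rw [hη]; positivity)), h2⟩
    obtain ⟨z', hz'⟩ := exists_cubicOfRoots_eq hz.self
    have hUy₀ := hy₀
    rw [hU] at hUy₀
    have hy₀eq : φ.symm (cubicOfRoots (z y₀, z')) = y₀ := by
      rw [hz', ← hφ, φ.left_inv hUy₀.1]
    obtain ⟨-, hgR, hgB⟩ := hgood ε hεn
    -- A path of configurations starting with first root `z y₀` and ending with first root `ζ + ε`
    -- continues the given germ to the branch that is about to be permuted.
    obtain ⟨σ, hσ⟩ := joinedIn_rootDifferences_ne_zero_ball (ρ := ρ) (A := (z y₀, z'))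
      (B := (ζ + ε, ζ - ε))
      (fun h => hD₀ (by
        have := discr_cubicOfRoots (z y₀, z')
        rw [hz', h] at this
        simpa [discr] using this)) hgR
      (by rw [hz', ← hφ]; simpa using hUy₀.2) hgB
    obtain ⟨γ, -, hγU, hγD, hγr⟩ := exists_path_of_roots hφ hρ hU σ hσ
    have hrot : ∀ s : unitInterval, ‖ε * Complex.exp ((s : ℝ) * Real.pi * Complex.I)‖ = δ / 2 := by
      intro s
      have := Complex.norm_exp_ofReal_mul_I ((s : ℝ) * Real.pi)
      push_cast at this
      rw [norm_mul, this, hεn, mul_one]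
    -- A half turn of `η` exchanges the two roots, but `η ^ 2` returns to its start: the image in
    -- the base is a loop.
    let τ : Path ((ζ + ε, ζ - ε) : ℂ × ℂ) (ζ - ε, ζ + ε) :=
      { toFun := fun s => (ζ + ε * Complex.exp ((s : ℝ) * Real.pi * Complex.I),
          ζ - ε * Complex.exp ((s : ℝ) * Real.pi * Complex.I))
        continuous_toFun := by fun_prop
        source' := by simp
        target' := by simp [sub_eq_add_neg] }
    obtain ⟨κ, hκ, hκU, hκD, hκr⟩ := exists_path_of_roots hφ hρ hU τ
      (fun s => (hgood _ (hrot s)).2)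
    have hend : φ.symm (cubicOfRoots (ζ + ε, ζ - ε)) = φ.symm (cubicOfRoots (ζ - ε, ζ + ε)) := by
      congr 1
      exact Prod.ext (by simp only [cubicOfRoots]; ring) (by simp only [cubicOfRoots]; ring)
    obtain ⟨Z, hZ, hZc⟩ := exists_continuation_of_roots (a := a) γ (fun s => ha _ (hγU s).1)
      (fun s => hp _ (hγU s).1) (fun s => hq _ (hγU s).1) hγD
      (ζ := fun s => (σ s).1) (by fun_prop) hγr
    obtain ⟨Y, hY, hYc⟩ := exists_continuation_of_roots (a := a) κ (fun s => ha _ (hκU s).1)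
      (fun s => hp _ (hκU s).1) (fun s => hq _ (hκU s).1) hκD
      (ζ := fun s => (τ s).1) (by fun_prop) hκr
    refine ⟨φ.symm (cubicOfRoots (ζ + ε, ζ - ε)), γ.cast hy₀eq.symm rfl, κ.cast rfl hend,
      fun s w => a w + Z s w, fun s w => a w + Y s w, hγU, fun s => ⟨?_, hκU s⟩, hZc, ?_, hYc,
      ?_, ?_⟩
    · change κ s ∈ W
      rw [hκ]
      exact (hgood _ (hrot s)).1
    · have h0 := hZ 0
      rw [γ.source, hy₀eq, σ.source] at h0
      exact add_root_eventuallyEq (hp _ hy₀) (hq _ hy₀) hD₀ h0.1 hz h0.2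
    · have h0 := hY 0
      have h1 := hZ 1
      have hw := hγU 1
      have hDw := hγD 1
      rw [κ.source, τ.source] at h0
      rw [γ.target, σ.target] at h1
      rw [γ.target] at hw hDw
      exact add_root_eventuallyEq (hp _ hw.1) (hq _ hw.1) hDw h0.1 h1.1 (h0.2.trans h1.2.symm)
    · intro h
      have h0 := (hY 0).2
      have h1 := (hY 1).2
      rw [κ.source, τ.source] at h0
      rw [κ.target, ← hend, τ.target] at h1
      have he := h.eq_of_nhds
      simp only [h0, h1] at he
      have h2 : 2 * ε = 0 := by linear_combination -he
      exact hε0 (by simpa using h2)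

end Chart

/-! ### From branches to the system and back; uniqueness of `a`, `p`, `q` -/

theorem eq_zero_of_three_zeros {A B C z₁ z₂ z₃ : ℂ} (h₁₂ : z₁ ≠ z₂) (h₁₃ : z₁ ≠ z₃)
    (h₂₃ : z₂ ≠ z₃) (h₁ : A + B * z₁ + C * z₁ ^ 2 = 0) (h₂ : A + B * z₂ + C * z₂ ^ 2 = 0)
    (h₃ : A + B * z₃ + C * z₃ ^ 2 = 0) : A = 0 ∧ B = 0 ∧ C = 0 := by
  have e₁₂ : B + C * (z₁ + z₂) = 0 :=
    (mul_eq_zero.1 (show (z₁ - z₂) * (B + C * (z₁ + z₂)) = 0 by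
      linear_combination h₁ - h₂)).resolve_left (sub_ne_zero.2 h₁₂)
  have e₁₃ : B + C * (z₁ + z₃) = 0 :=
    (mul_eq_zero.1 (show (z₁ - z₃) * (B + C * (z₁ + z₃)) = 0 by
      linear_combination h₁ - h₃)).resolve_left (sub_ne_zero.2 h₁₃)
  have hC : C = 0 :=
    (mul_eq_zero.1 (show (z₂ - z₃) * C = 0 by
      linear_combination e₁₂ - e₁₃)).resolve_left (sub_ne_zero.2 h₂₃)
  have hB : B = 0 := by simpa [hC] using e₁₂
  exact ⟨by simpa [hB, hC] using h₁, hB, hC⟩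

theorem exists_three_roots {P Q : ℂ} (hD : 4 * P ^ 3 - 27 * Q ^ 2 ≠ 0) :
    ∃ z₁ z₂ z₃ : ℂ, (z₁ ≠ z₂ ∧ z₁ ≠ z₃ ∧ z₂ ≠ z₃) ∧ z₁ ^ 3 = P * z₁ + Q ∧
      z₂ ^ 3 = P * z₂ + Q ∧ z₃ ^ 3 = P * z₃ + Q := by
  obtain ⟨z₁, h₁⟩ : ∃ z : ℂ, z ^ 3 = P * z + Q := by
    open Polynomial in
    obtain ⟨z, hz⟩ := IsAlgClosed.exists_root (X ^ 3 - (C P * X + C Q) : ℂ[X]) (by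
      have : (X ^ 3 - (C P * X + C Q) : ℂ[X]).degree = 3 := by compute_degree!
      rw [this]
      decide)
    exact ⟨z, by simpa [sub_eq_zero] using hz⟩
  obtain ⟨z₂, h₂⟩ := exists_cubicOfRoots_eq h₁
  have hdiff : rootDifferences (z₁, z₂) ≠ 0 := fun h => hD (by
    have := discr_cubicOfRoots (z₁, z₂)
    rw [h₂, h] at this
    simpa using this)
  simp only [rootDifferences, mul_ne_zero_iff] at hdiff
  obtain ⟨⟨d₁, d₂⟩, d₃⟩ := hdiff
  simp only [cubicOfRoots, Prod.mk.injEq] at h₂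
  obtain ⟨rfl, rfl⟩ := h₂
  refine ⟨z₁, z₂, -z₁ - z₂, ⟨fun h => d₁ (by linear_combination h),
    fun h => d₂ (by linear_combination h), fun h => d₃ (by linear_combination h)⟩, h₁, ?_, ?_⟩ <;>
  ring

theorem fderiv_apply_space {f : ℂ × ℂ → ℂ} {g : ℂ → ℂ} {x₀ g' : ℂ}
    (hf : DifferentiableAt ℂ f (0, x₀)) (h : ∀ᶠ x in 𝓝 x₀, f (0, x) = g x)
    (hg : HasDerivAt g g' x₀) : fderiv ℂ f (0, x₀) (0, 1) = g' := by
  have hl : HasDerivAt (fun x : ℂ => ((0, x) : ℂ × ℂ)) (0, 1) x₀ :=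
    (hasDerivAt_const x₀ (0 : ℂ)).prodMk (hasDerivAt_id x₀)
  exact (hf.hasFDerivAt.comp_hasDerivAt x₀ hl).unique (hg.congr_of_eventuallyEq h)

/-- If all branches of `a + z` solve the equation at a point off the cusp, then `a`, `p`, `q`
satisfy the corresponding first order system there. -/
theorem coeff_eq_zero_of_branches {a p q : ℂ × ℂ → ℂ} {y : ℂ × ℂ} (ha : AnalyticAt ℂ a y)
    (hp : AnalyticAt ℂ p y) (hq : AnalyticAt ℂ q y) (hD : discr p q y ≠ 0)
    (h : ∀ z, IsCubicRootNear p q z y → SolvesBurgersNear (fun w => a w + z w) y) :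
    coeffZero a p q y = 0 ∧ coeffOne a p q y = 0 ∧ coeffTwo a p y = 0 := by
  have key : ∀ ζ : ℂ, ζ ^ 3 = p y * ζ + q y →
      coeffZero a p q y + coeffOne a p q y * ζ + coeffTwo a p y * ζ ^ 2 = 0 := by
    intro ζ hζ
    obtain ⟨z, hz, rfl, -⟩ :=
      exists_isCubicRootNear hp hq hζ (three_mul_sq_ne_of_discr_ne_zero hζ hD)
    rw [← burgers_add_root ha hp hq hz, (h z hz).2.self_of_nhds, mul_zero]
  obtain ⟨z₁, z₂, z₃, ⟨d₁, d₂, d₃⟩, h₁, h₂, h₃⟩ := exists_three_roots hD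
  exact eq_zero_of_three_zeros d₁ d₂ d₃ (key _ h₁) (key _ h₂) (key _ h₃)

/-- Conversely, the system implies that simple branches of `a + z` solve the equation. -/
theorem solvesBurgersNear_of_coeff_eq_zero {a p q z : ℂ × ℂ → ℂ} {y : ℂ × ℂ}
    (ha : AnalyticAt ℂ a y) (hp : AnalyticAt ℂ p y) (hq : AnalyticAt ℂ q y)
    (hs : 3 * z y ^ 2 ≠ p y) (hz : IsCubicRootNear p q z y)
    (h : ∀ᶠ w in 𝓝 y, coeffZero a p q w = 0 ∧ coeffOne a p q w = 0 ∧ coeffTwo a p w = 0) :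
    SolvesBurgersNear (fun w => a w + z w) y := by
  refine ⟨ha.add hz.1, ?_⟩
  have hs' : ∀ᶠ w in 𝓝 y, 3 * z w ^ 2 - p w ≠ 0 :=
    ((continuousAt_const.mul (hz.1.continuousAt.pow 2)).sub hp.continuousAt).eventually_ne
      (sub_ne_zero.2 hs)
  filter_upwards [h, hs', hz.eventually, ha.eventually_analyticAt, hp.eventually_analyticAt,
    hq.eventually_analyticAt] with w ⟨h0, h1, h2⟩ hs hz ha hp hq
  have := burgers_add_root ha hp hq hz
  rw [h0, h1, h2] at this
  exact (mul_eq_zero.1 (by simpa using this)).resolve_left hs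

/-- At a multiple root, `D_v = 108 ζ ^ 3 (ζ p_v + q_v)`, so `D_t - (a + ζ) D_x` is `108 ζ ^ 3` times
the quadratic polynomial of the system at `ζ`. -/
theorem cuspIsCharacteristic_of_coeff_eq_zero {a p q : ℂ × ℂ → ℂ} {U : Set (ℂ × ℂ)}
    (hp : AnalyticOnNhd ℂ p U) (hq : AnalyticOnNhd ℂ q U)
    (h : ∀ w ∈ U, coeffZero a p q w = 0 ∧ coeffOne a p q w = 0 ∧ coeffTwo a p w = 0) :
    CuspIsCharacteristic U a p q := by
  intro y hy ζ hζ hζ2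
  obtain ⟨h0, h1, h2⟩ := h y hy.1
  have hD : ∀ v, fderiv ℂ (discr p q) y v =
      12 * p y ^ 2 * fderiv ℂ p y v - 54 * q y * fderiv ℂ q y v := by
    intro v
    have hd : HasFDerivAt (discr p q) _ y :=
      (((hp y hy.1).differentiableAt.hasFDerivAt.pow 3).const_mul 4).sub
        (((hq y hy.1).differentiableAt.hasFDerivAt.pow 2).const_mul 27)
    rw [hd.fderiv]
    simp
    ring
  have hqζ : q y = -2 * ζ ^ 3 := by linear_combination -hζ + ζ * hζ2
  simp only [timeDeriv, spaceDeriv, coeffZero, coeffOne, coeffTwo, hD] at h0 h1 h2 ⊢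
  rw [← hζ2, hqζ] at h0 ⊢
  rw [← hζ2] at h1
  linear_combination 108 * ζ ^ 4 * h1 + 108 * ζ ^ 3 * (h0 + ζ ^ 2 * h2)

/-- Functions `a`, `p`, `q` whose branches solve the equation with the same initial values agree. -/
theorem eventuallyEq_of_coeff_eq_zero {a p q a' p' q' : ℂ × ℂ → ℂ} {x₁ : ℂ} (hx₁ : x₁ ≠ 0)
    (ha : AnalyticAt ℂ a (0, x₁)) (hp : AnalyticAt ℂ p (0, x₁)) (hq : AnalyticAt ℂ q (0, x₁))
    (ha' : AnalyticAt ℂ a' (0, x₁)) (hp' : AnalyticAt ℂ p' (0, x₁))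
    (hq' : AnalyticAt ℂ q' (0, x₁))
    (h : ∀ᶠ w in 𝓝 (0, x₁), coeffZero a p q w = 0 ∧ coeffOne a p q w = 0 ∧ coeffTwo a p w = 0)
    (h' : ∀ᶠ w in 𝓝 (0, x₁),
      coeffZero a' p' q' w = 0 ∧ coeffOne a' p' q' w = 0 ∧ coeffTwo a' p' w = 0)
    (hi : ∀ᶠ x in 𝓝 x₁, p (0, x) = 0 ∧ q (0, x) = x)
    (hi' : ∀ᶠ x in 𝓝 x₁, a' (0, x) = a (0, x) ∧ p' (0, x) = 0 ∧ q' (0, x) = x) :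
    ∀ᶠ w in 𝓝 (0, x₁), a' w = a w ∧ p' w = p w ∧ q' w = q w := by
  obtain ⟨hp1, hq1⟩ := hi.self_of_nhds
  obtain ⟨-, hp1', hq1'⟩ := hi'.self_of_nhds
  -- Branches of the two families with the same initial value coincide, so `a - a' + z` is a root of
  -- the second cubic.
  have key : ∀ ζ : ℂ, ζ ^ 3 = x₁ → ∃ z, IsCubicRootNear p q z (0, x₁) ∧ z (0, x₁) = ζ ∧
      ∀ᶠ w in 𝓝 (0, x₁), (a w - a' w + z w) ^ 3 = p' w * (a w - a' w + z w) + q' w := by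
    intro ζ hζ
    have hζ0 : 3 * ζ ^ 2 ≠ 0 := by
      have : ζ ≠ 0 := by rintro rfl; exact hx₁ (by simpa using hζ.symm)
      simpa using this
    obtain ⟨z, hz, hzv, hu⟩ := exists_isCubicRootNear hp hq (ζ := ζ) (by simp [hp1, hq1, hζ])
      (by rwa [hp1])
    obtain ⟨z', hz', hzv', -⟩ := exists_isCubicRootNear hp' hq' (ζ := ζ)
      (by simp [hp1', hq1', hζ]) (by rwa [hp1'])
    refine ⟨z, hz, hzv, ?_⟩
    have hl : Tendsto (fun x : ℂ => ((0, x) : ℂ × ℂ)) (𝓝 x₁) (𝓝 (0, x₁)) :=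
      tendsto_const_nhds.prodMk_nhds tendsto_id
    have hl' : Tendsto (fun x : ℂ => (((0, x), z' (0, x)) : (ℂ × ℂ) × ℂ)) (𝓝 x₁)
        (𝓝 ((0, x₁), ζ)) :=
      hl.prodMk_nhds (hzv' ▸ hz'.1.continuousAt.tendsto.comp hl)
    have heq := (solvesBurgersNear_of_coeff_eq_zero ha' hp' hq' (by rwa [hzv', hp1']) hz'
      h').eventuallyEq (solvesBurgersNear_of_coeff_eq_zero ha hp hq (by rwa [hzv, hp1]) hz h) (by
        filter_upwards [hi, hi', hl'.eventually hu, hl.eventually hz'.2]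
          with x ⟨e1, e2⟩ ⟨e3, e4, e5⟩ hu hr
        rw [e3, hu (by rw [hr, e1, e2, e4, e5])])
    filter_upwards [heq, hz'.2] with w hw hr
    have : z' w = a w - a' w + z w := by linear_combination hw
    rw [← this, hr]
  obtain ⟨ζ₁, ζ₂, ζ₃, ⟨d₁, d₂, d₃⟩, e₁, e₂, e₃⟩ := exists_three_roots (P := 0) (Q := x₁)
    (by simp [hx₁])
  simp only [zero_mul, zero_add] at e₁ e₂ e₃
  obtain ⟨z₁, hz₁, v₁, r₁⟩ := key ζ₁ e₁
  obtain ⟨z₂, hz₂, v₂, r₂⟩ := key ζ₂ e₂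
  obtain ⟨z₃, hz₃, v₃, r₃⟩ := key ζ₃ e₃
  have hne : ∀ {f g : ℂ × ℂ → ℂ}, IsCubicRootNear p q f (0, x₁) → IsCubicRootNear p q g (0, x₁) →
      f (0, x₁) ≠ g (0, x₁) → ∀ᶠ w in 𝓝 (0, x₁), f w ≠ g w := fun hf hg hfg => by
    filter_upwards [(hf.1.continuousAt.sub hg.1.continuousAt).eventually_ne (sub_ne_zero.2 hfg)]
      with w hw
    exact sub_ne_zero.1 hw
  filter_upwards [r₁, r₂, r₃, hz₁.2, hz₂.2, hz₃.2, hne hz₁ hz₂ (by rwa [v₁, v₂]),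
    hne hz₁ hz₃ (by rwa [v₁, v₃]), hne hz₂ hz₃ (by rwa [v₂, v₃])]
    with w r₁ r₂ r₃ s₁ s₂ s₃ n₁ n₂ n₃
  -- The difference of the second cubic at `a - a' + z` and the first at `z` is quadratic in `z`
  -- with three distinct zeros.
  obtain ⟨g0, g1, g2⟩ := eq_zero_of_three_zeros
    (A := q w + (a w - a' w) ^ 3 - p' w * (a w - a' w) - q' w)
    (B := p w + 3 * (a w - a' w) ^ 2 - p' w) (C := 3 * (a w - a' w)) n₁ n₂ n₃
    (by linear_combination r₁ - s₁) (by linear_combination r₂ - s₂)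
    (by linear_combination r₃ - s₃)
  have ga : a w - a' w = 0 := by simpa using g2
  rw [ga] at g0 g1
  exact ⟨by linear_combination -ga, by linear_combination -g1, by linear_combination -g0⟩

/-- Branches of `a + z` satisfying the implicit equation solve `u_t = u u_x`. -/
theorem solvesBurgersNear_of_implicit {a₀ : ℂ → ℂ} {a p q z : ℂ × ℂ → ℂ} {y : ℂ × ℂ}
    (ha : AnalyticAt ℂ a y)
    (h : ∀ᶠ w in 𝓝 y, ∀ ζ : ℂ, ζ ^ 3 = p w * ζ + q w →
      AnalyticAt ℂ a₀ (w.2 + w.1 * (a w + ζ)) ∧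
      (a w + ζ - a₀ (w.2 + w.1 * (a w + ζ))) ^ 3 = w.2 + w.1 * (a w + ζ))
    (hz : IsCubicRootNear p q z y) : SolvesBurgersNear (fun w => a w + z w) y := by
  refine ⟨ha.add hz.1, ?_⟩
  filter_upwards [eventually_eventually_nhds.2 h, ha.eventually_analyticAt, hz.eventually]
    with w h ha hz
  refine burgers_of_implicit (a₀ := a₀) (ha.add hz.1) ?_ (h.self_of_nhds _ hz.self).1
  filter_upwards [h, hz.2] with v hv hzv
  exact (hv _ hzv).2

/-- Uniqueness of the germs `a`, `p`, `q` at the origin. -/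
theorem eventuallyEq_of_exists_branch {a₀ : ℂ → ℂ} {a p q : ℂ × ℂ → ℂ}
    (ha : AnalyticAt ℂ a (0, 0)) (hp : AnalyticAt ℂ p (0, 0)) (hq : AnalyticAt ℂ q (0, 0))
    (hi : ∀ᶠ x in 𝓝 (0 : ℂ), a (0, x) = a₀ x ∧ p (0, x) = 0 ∧ q (0, x) = x)
    (h : ∀ᶠ w in 𝓝 ((0, 0) : ℂ × ℂ),
      coeffZero a p q w = 0 ∧ coeffOne a p q w = 0 ∧ coeffTwo a p w = 0)
    {U' : Set (ℂ × ℂ)} {a' p' q' : ℂ × ℂ → ℂ} (hU' : HolomorphicNearOrigin U' a' p' q')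
    (hi' : ∀ᶠ x in 𝓝 (0 : ℂ), a' (0, x) = a₀ x ∧ p' (0, x) = 0 ∧ q' (0, x) = x)
    {y : ℂ × ℂ} (hy : y ∈ U') {z' : ℂ × ℂ → ℂ} (hz' : IsCubicRootNear p' q' z' y)
    (hb : SolvesBurgersNear (fun w => a' w + z' w) y) :
    a' =ᶠ[𝓝 (0, 0)] a ∧ p' =ᶠ[𝓝 (0, 0)] p ∧ q' =ᶠ[𝓝 (0, 0)] q := by
  have ha0 := hU'.analytic_a _ hU'.zero_mem
  have hp0 := hU'.analytic_p _ hU'.zero_mem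
  have hq0 := hU'.analytic_q _ hU'.zero_mem
  set N : ℂ × ℂ → ℂ := fun w => cubicNorm (p' w) (q' w) (coeffZero a' p' q' w)
    (coeffOne a' p' q' w) (coeffTwo a' p' w) with hN
  have hNan : AnalyticOnNhd ℂ N U' := fun w hw => by
    have h1 := hU'.analytic_p w hw
    have h2 := hU'.analytic_q w hw
    have h3 := analyticAt_coeffZero (hU'.analytic_a w hw) h1 h2
    have h4 := analyticAt_coeffOne (hU'.analytic_a w hw) h1 h2
    have h5 := analyticAt_coeffTwo (hU'.analytic_a w hw) h1
    unfold N cubicNorm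
    fun_prop
  have hNy : N =ᶠ[𝓝 y] 0 := by
    filter_upwards [hz'.eventually, hb.2, hU'.isOpen.mem_nhds hy] with w hz hb hw
    refine cubicNorm_eq_zero_of_root hz.self ?_
    rw [← burgers_add_root (hU'.analytic_a w hw) (hU'.analytic_p w hw) (hU'.analytic_q w hw) hz,
      hb, mul_zero]
  have hN0 := hNan.eqOn_zero_of_preconnected_of_eventuallyEq_zero hU'.isPreconnected hy hNy
  obtain ⟨-, hp00, hq00⟩ := hi'.self_of_nhds
  have hqx : fderiv ℂ q' (0, 0) (0, 1) = 1 :=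
    fderiv_apply_space hq0.differentiableAt (hi'.mono fun x hx => hx.2.2) (hasDerivAt_id 0)
  have h' : ∀ᶠ w in 𝓝 ((0, 0) : ℂ × ℂ),
      coeffZero a' p' q' w = 0 ∧ coeffOne a' p' q' w = 0 ∧ coeffTwo a' p' w = 0 :=
    eventually_coeff_eq_zero hp0 hq0 (analyticAt_coeffZero ha0 hp0 hq0)
      (analyticAt_coeffOne ha0 hp0 hq0) (analyticAt_coeffTwo ha0 hp0) hp00 hq00
      (by rw [show (0 : ℂ × ℂ) = (0, 0) from rfl, hqx]; exact one_ne_zero)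
      (by filter_upwards [hU'.isOpen.mem_nhds hU'.zero_mem] with w hw using hN0 hw)
  obtain ⟨R, hR, hball⟩ := Metric.eventually_nhds_iff_ball.1
    (((ha.eventually_analyticAt.and hp.eventually_analyticAt).and hq.eventually_analyticAt).and
      (((ha0.eventually_analyticAt.and hp0.eventually_analyticAt).and
        hq0.eventually_analyticAt).and (h.and h')))
  have hl : Tendsto (fun x : ℂ => ((0, x) : ℂ × ℂ)) (𝓝 0) (𝓝 (0, 0)) :=
    tendsto_const_nhds.prodMk_nhds tendsto_id
  -- The comparison is made at a point `(0, x₁)` off the cusp, where all branches are simple, and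
  -- carried back to the origin by the identity theorem.
  obtain ⟨x₁, ⟨hx₁R, hx₁i, hx₁i'⟩, hx₁⟩ := ((((hl.eventually (Metric.ball_mem_nhds _ hR)).and
    ((eventually_eventually_nhds.2 hi).and (eventually_eventually_nhds.2 hi'))).filter_mono
      nhdsWithin_le_nhds).and (self_mem_nhdsWithin (s := {(0 : ℂ)}ᶜ))).exists
  have hx₁ : x₁ ≠ 0 := hx₁
  have hnear : ∀ᶠ w in 𝓝 ((0, x₁) : ℂ × ℂ), w ∈ Metric.ball ((0, 0) : ℂ × ℂ) R :=
    Metric.isOpen_ball.mem_nhds hx₁R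
  obtain ⟨⟨⟨b1, b2⟩, b3⟩, ⟨⟨b4, b5⟩, b6⟩, -⟩ := hball _ hx₁R
  have heq := eventuallyEq_of_coeff_eq_zero hx₁ b1 b2 b3 b4 b5 b6
    (hnear.mono fun w hw => (hball w hw).2.2.1) (hnear.mono fun w hw => (hball w hw).2.2.2)
    (hx₁i.mono fun x hx => hx.2)
    (by
      filter_upwards [hx₁i, hx₁i'] with x h1 h2
      exact ⟨h2.1.trans h1.1.symm, h2.2⟩)
  have ident : ∀ {f g : ℂ × ℂ → ℂ}, AnalyticOnNhd ℂ f (Metric.ball (0, 0) R) →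
      AnalyticOnNhd ℂ g (Metric.ball (0, 0) R) → f =ᶠ[𝓝 (0, x₁)] g → f =ᶠ[𝓝 (0, 0)] g :=
    fun hf hg hfg => by
      filter_upwards [Metric.ball_mem_nhds _ hR] with w hw
      exact hf.eqOn_of_preconnected_of_eventuallyEq hg (convex_ball _ _).isPreconnected hx₁R hfg hw
  exact ⟨ident (fun w hw => (hball w hw).2.1.1.1) (fun w hw => (hball w hw).1.1.1)
      (heq.mono fun _ h => h.1),
    ident (fun w hw => (hball w hw).2.1.1.2) (fun w hw => (hball w hw).1.1.2)
      (heq.mono fun _ h => h.2.1),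
    ident (fun w hw => (hball w hw).2.1.2) (fun w hw => (hball w hw).1.2)
      (heq.mono fun _ h => h.2.2)⟩

end RamifiedBurgers

/-! ### The main theorem -/

open RamifiedBurgers in
theorem mainTheorem1 (a₀ : ℂ → ℂ) (ha₀ : AnalyticAt ℂ a₀ 0) :
    ∃ (U : Set (ℂ × ℂ)) (a p q : ℂ × ℂ → ℂ),
      HolomorphicNearOrigin U a p q ∧
      -- initial conditions
      (∀ x : ℂ, (0, x) ∈ U → a (0, x) = a₀ x ∧ p (0, x) = 0 ∧ q (0, x) = x) ∧
      -- every holomorphic branch of `a + z` solves the equation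
      (∀ y ∈ U, ∀ z, IsCubicRootNear p q z y → SolvesBurgersNear (fun w => a w + z w) y) ∧
      -- for every branch of the datum, `a + z` is the unique solution germ, and it is
      -- ramified around the cusp; all its continuations are solutions of the same form
      (∀ x₀ : ℂ, x₀ ≠ 0 → (0, x₀) ∈ U → ∀ ω, IsCubeRootGerm ω x₀ →
        ∃ z, IsCubicRootNear p q z (0, x₀) ∧
          SolvesIVP a₀ ω x₀ (fun w => a w + z w) ∧
          (∀ v, SolvesIVP a₀ ω x₀ v → v =ᶠ[𝓝 (0, x₀)] fun w => a w + z w) ∧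
          IsRamifiedAround U (cusp U p q) (0, x₀) (fun w => a w + z w) ∧
          (∀ (y₁ : ℂ × ℂ) (γ : Path ((0 : ℂ), x₀) y₁) (f : unitInterval → ℂ × ℂ → ℂ),
            (∀ s, γ s ∈ U \ cusp U p q) → IsContinuationAlong γ f →
            (f 0 =ᶠ[𝓝 (0, x₀)] fun w => a w + z w) →
            ∀ s, SolvesBurgersNear (f s) (γ s) ∧
              IsCubicRootNear p q (fun w => f s w - a w) (γ s))) ∧
      -- the singular locus is a genuine cusp with edge at the origin, and is characteristic
      (p (0, 0) = 0 ∧ q (0, 0) = 0 ∧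
        LinearIndependent ℂ ![fderiv ℂ p (0, 0), fderiv ℂ q (0, 0)]) ∧
      CuspIsCharacteristic U a p q ∧
      -- uniqueness of the germs `a`, `p`, `q`
      (∀ (U' : Set (ℂ × ℂ)) (a' p' q' : ℂ × ℂ → ℂ),
        HolomorphicNearOrigin U' a' p' q' →
        (∀ᶠ x in 𝓝 (0 : ℂ), a' (0, x) = a₀ x ∧ p' (0, x) = 0 ∧ q' (0, x) = x) →
        (∃ y ∈ U', ∃ z', IsCubicRootNear p' q' z' y ∧
          SolvesBurgersNear (fun w => a' w + z' w) y) →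
        a' =ᶠ[𝓝 (0, 0)] a ∧ p' =ᶠ[𝓝 (0, 0)] p ∧ q' =ᶠ[𝓝 (0, 0)] q) := by
  obtain ⟨a, p, q, ha, hp, hq, hi, himp⟩ := exists_coefficients ha₀
  obtain ⟨p00, q00⟩ := hi.self_of_nhds.2
  have hpx : fderiv ℂ p (0, 0) (0, 1) = 0 := fderiv_apply_space hp.differentiableAt
    (hi.mono fun x hx => hx.2.1) (hasDerivAt_const _ _)
  have hqx : fderiv ℂ q (0, 0) (0, 1) = 1 := fderiv_apply_space hq.differentiableAt
    (hi.mono fun x hx => hx.2.2) (hasDerivAt_id 0)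
  have hi2 : ∀ᶠ w in 𝓝 ((0, 0) : ℂ × ℂ), a (0, w.2) = a₀ w.2 ∧ p (0, w.2) = 0 ∧ q (0, w.2) = w.2 :=
    (continuousAt_snd : Tendsto Prod.snd (𝓝 ((0, 0) : ℂ × ℂ)) (𝓝 0)).eventually hi
  obtain ⟨R, hR, hball⟩ := Metric.eventually_nhds_iff_ball.1
    (((ha.eventually_analyticAt.and hp.eventually_analyticAt).and hq.eventually_analyticAt).and
      (hi2.and himp))
  set O : Set (ℂ × ℂ) := Metric.ball (0, 0) R with hO
  have hOo : IsOpen O := Metric.isOpen_ball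
  have h0O : ((0, 0) : ℂ × ℂ) ∈ O := Metric.mem_ball_self hR
  have aO : AnalyticOnNhd ℂ a O := fun w hw => (hball w hw).1.1.1
  have pO : AnalyticOnNhd ℂ p O := fun w hw => (hball w hw).1.1.2
  have qO : AnalyticOnNhd ℂ q O := fun w hw => (hball w hw).1.2
  have valO : ∀ x : ℂ, (0, x) ∈ O → a (0, x) = a₀ x ∧ p (0, x) = 0 ∧ q (0, x) = x :=
    fun x hx => (hball _ hx).2.1
  have bO : ∀ y ∈ O, ∀ z, IsCubicRootNear p q z y → SolvesBurgersNear (fun w => a w + z w) y :=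
    fun y hy z hz => solvesBurgersNear_of_implicit (a₀ := a₀) (aO y hy)
      (by filter_upwards [hOo.mem_nhds hy] with w hw using (hball w hw).2.2) hz
  have dO : ∀ x : ℂ, x ≠ 0 → (0, x) ∈ O → discr p q (0, x) ≠ 0 := fun x hx hxO => by
    simp [discr, (valO x hxO).2.1, (valO x hxO).2.2, hx]
  -- Near `(0, x₁)` with `x₁ ≠ 0` the discriminant is nonzero, so the three branches force the
  -- system; the identity theorem extends it to `O`, including the cusp.
  have cO : ∀ w ∈ O, coeffZero a p q w = 0 ∧ coeffOne a p q w = 0 ∧ coeffTwo a p w = 0 := by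
    have hl : Tendsto (fun x : ℂ => ((0, x) : ℂ × ℂ)) (𝓝[≠] 0) (𝓝 (0, 0)) :=
      tendsto_const_nhds.prodMk_nhds (tendsto_id.mono_left nhdsWithin_le_nhds)
    obtain ⟨x₁, hx₁O, hx₁⟩ := ((hl.eventually (hOo.mem_nhds h0O)).and self_mem_nhdsWithin).exists
    have hD : ∀ᶠ w in 𝓝 ((0, x₁) : ℂ × ℂ), discr p q w ≠ 0 :=
      ((continuousAt_const.mul ((pO _ hx₁O).continuousAt.pow 3)).sub
        (continuousAt_const.mul ((qO _ hx₁O).continuousAt.pow 2))).eventually_ne (dO x₁ hx₁ hx₁O)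
    have hc : ∀ᶠ w in 𝓝 ((0, x₁) : ℂ × ℂ),
        coeffZero a p q w = 0 ∧ coeffOne a p q w = 0 ∧ coeffTwo a p w = 0 := by
      filter_upwards [hD, hOo.mem_nhds hx₁O] with w hD hw
      exact coeff_eq_zero_of_branches (aO w hw) (pO w hw) (qO w hw) hD (bO w hw)
    have ident : ∀ {f : ℂ × ℂ → ℂ}, AnalyticOnNhd ℂ f O → f =ᶠ[𝓝 (0, x₁)] 0 →
        ∀ w ∈ O, f w = 0 := fun hf h w hw =>
      hf.eqOn_zero_of_preconnected_of_eventuallyEq_zero (convex_ball _ _).isPreconnected hx₁O h hw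
    intro w hw
    exact ⟨ident (fun w hw => analyticAt_coeffZero (aO w hw) (pO w hw) (qO w hw))
        (hc.mono fun _ h => h.1) w hw,
      ident (fun w hw => analyticAt_coeffOne (aO w hw) (pO w hw) (qO w hw))
        (hc.mono fun _ h => h.2.1) w hw,
      ident (fun w hw => analyticAt_coeffTwo (aO w hw) (pO w hw)) (hc.mono fun _ h => h.2.2) w hw⟩
  have hpt : fderiv ℂ p (0, 0) (1, 0) = 1 := by
    have := (cO _ h0O).2.1
    simp only [coeffOne, timeDeriv, spaceDeriv, hpx, hqx, p00] at this
    linear_combination this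
  have hdecomp : ∀ (L : ℂ × ℂ →L[ℂ] ℂ) (v : ℂ × ℂ), L v = v.1 * L (1, 0) + v.2 * L (0, 1) := by
    intro L v
    conv_lhs => rw [show v = v.1 • ((1, 0) : ℂ × ℂ) + v.2 • ((0, 1) : ℂ × ℂ) by ext <;> simp]
    rw [map_add, map_smul, map_smul, smul_eq_mul, smul_eq_mul]
  obtain ⟨φ₀, h0φ, hφ₀⟩ := exists_openPartialHomeomorph (f := fun w => (p w, q w)) (hp.prod hq)
    (fun v hv => by
      rw [(hp.differentiableAt.hasFDerivAt.prodMk hq.differentiableAt.hasFDerivAt).fderiv] at hv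
      have h1 : fderiv ℂ p (0, 0) v = 0 := congrArg Prod.fst hv
      have h2 : fderiv ℂ q (0, 0) v = 0 := congrArg Prod.snd hv
      rw [hdecomp, hpx, hpt] at h1
      have hv1 : v.1 = 0 := by linear_combination h1
      rw [hdecomp, hqx, hv1] at h2
      exact Prod.ext hv1 (by simpa using h2))
  set φ := φ₀.restrOpen O hOo with hφdef
  have hφ : ∀ y, φ y = (p y, q y) := fun y => congrFun hφ₀ y
  have hφs : φ.source = φ₀.source ∩ O := φ₀.restrOpen_source O hOo
  have h0s : ((0, 0) : ℂ × ℂ) ∈ φ.source := by rw [hφs]; exact ⟨h0φ, h0O⟩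
  have hφ0 : φ (0, 0) = 0 := by rw [hφ, p00, q00]; rfl
  obtain ⟨ρ, hρ, hρt⟩ := Metric.isOpen_iff.1 φ.open_target 0 (hφ0 ▸ φ.map_source h0s)
  -- Choosing `U` as the preimage of a ball in the `(p, q)`-chart makes it connected and lets
  -- scaling of roots construct paths inside it.
  obtain ⟨U, hU⟩ : ∃ U, U = φ.source ∩ φ ⁻¹' Metric.ball 0 ρ := ⟨_, rfl⟩
  have hUO : U ⊆ O := by
    rw [hU, hφs]
    exact fun w hw => hw.1.2
  have hUo : IsOpen U := hU ▸ φ.isOpen_inter_preimage Metric.isOpen_ball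
  have hUc : IsPreconnected U := by
    rw [hU, ← φ.symm_image_eq_source_inter_preimage hρt]
    exact (convex_ball _ _).isPreconnected.image _ (φ.continuousOn_symm.mono hρt)
  have h0U : ((0, 0) : ℂ × ℂ) ∈ U := by
    rw [hU]
    refine ⟨h0s, ?_⟩
    rw [Set.mem_preimage, hφ0]
    exact Metric.mem_ball_self hρ
  refine ⟨U, a, p, q, ⟨hUo, hUc, h0U, aO.mono hUO, pO.mono hUO, qO.mono hUO⟩,
    fun x hx => valO x (hUO hx), fun y hy => bO y (hUO hy), ?_, ⟨p00, q00, ?_⟩,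
    cuspIsCharacteristic_of_coeff_eq_zero (pO.mono hUO) (qO.mono hUO)
      (fun w hw => cO w (hUO hw)), ?_⟩
  · intro x₀ hx₀ hx₀U ω hω
    have hx₀O := hUO hx₀U
    obtain ⟨-, p0, q0⟩ := valO x₀ hx₀O
    have hroot : ω x₀ ^ 3 = p (0, x₀) * ω x₀ + q (0, x₀) := by
      rw [p0, q0, hω.2.self_of_nhds]
      ring
    have hD := dO x₀ hx₀ hx₀O
    obtain ⟨z, hz, hzv, hu⟩ := exists_isCubicRootNear (pO _ hx₀O) (qO _ hx₀O) hroot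
      (three_mul_sq_ne_of_discr_ne_zero hroot hD)
    have hl : Tendsto (fun x : ℂ => ((0, x) : ℂ × ℂ)) (𝓝 x₀) (𝓝 (0, x₀)) :=
      tendsto_const_nhds.prodMk_nhds tendsto_id
    have hIVP : SolvesIVP a₀ ω x₀ (fun w => a w + z w) := by
      refine ⟨bO _ hx₀O z hz, ?_⟩
      filter_upwards [hl.eventually (hOo.mem_nhds hx₀O), hω.2,
        (hl.prodMk_nhds hω.1.continuousAt.tendsto).eventually hu] with x hx hωx hux
      obtain ⟨i1, i2, i3⟩ := valO x hx
      rw [i1, ← hux (by rw [i2, i3, hωx]; ring)]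
    refine ⟨z, hz, hIVP, fun v hv => hv.1.eventuallyEq hIVP.1 ?_,
      isRamifiedAround_cusp hφ hρt hU (aO.mono hUO) (pO.mono hUO) (qO.mono hUO) hx₀U hD hz, ?_⟩
    · filter_upwards [hv.2, hIVP.2] with x h1 h2
      exact h1.trans h2.symm
    · intro y₁ γ f hγ hf hf0 s
      have hγO : ∀ s, γ s ∈ O := fun s => hUO (hγ s).1
      have hr := hf.isCubicRootNear (fun s => aO _ (hγO s)) (fun s => pO _ (hγO s))
        (fun s => qO _ (hγO s)) (by
          have hf0a : AnalyticAt ℂ (f 0) (0, x₀) := by simpa using hf.1 0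
          refine ⟨hf0a.sub (aO _ hx₀O), ?_⟩
          filter_upwards [hf0, hz.2] with w hw hzw
          rw [hw, add_sub_cancel_left, hzw]) s
      exact ⟨by simpa using bO _ (hγO s) _ hr, hr⟩
  · rw [LinearIndependent.pair_iff]
    intro s t hst
    have h1 := congrArg (fun L : ℂ × ℂ →L[ℂ] ℂ => L (0, 1)) hst
    have h2 := congrArg (fun L : ℂ × ℂ →L[ℂ] ℂ => L (1, 0)) hst
    simp [hpx, hqx] at h1
    simp [hpt, h1] at h2
    exact ⟨h2, h1⟩
  · rintro U' a' p' q' hU' hi' ⟨y, hy, z', hz', hb⟩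
    exact eventuallyEq_of_exists_branch ha hp hq hi
      (by filter_upwards [hOo.mem_nhds h0O] with w hw using cO w hw) hU' hi' hy hz' hb
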